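/- Conventions. A *prop* is a symmetric strict monoidal category whose objects are the natural numbers and whose tensor product is addition on objects; a *morphism of props* is a symmetric strict monoidal functor that is the identity on objects. A *special bicommutative bimonoid* $(X,\mu,\eta,\delta,\epsilon)$ in a symmetric monoidal category $\mathcal C$ is a commutative monoid $(X,\mu,\eta)$ together with a cocommutative comonoid $(X,\delta,\epsilon)$ satisfying the bimonoid laws $\delta\circ\mu=(\mu\otimes\mu)\circ(1\otimes\sigma\otimes 1)\circ(\delta\otimes\delta)$ (with $\sigma$ the symmetry), $\epsilon\circ\mu=\epsilon\otimes\epsilon$, $\delta\circ\eta=\eta\otimes\eta$, the extra law $\epsilon\circ\eta=\mathrm{id}_I$, and the special law $\mu\circ\delta=\mathrm{id}_X$. The morphisms of these structures are the morphisms of $\mathcal C$ commuting with all four operations. Let $\mathbf{Th}$ be the prop presented by generators $\mu:2\to1$, $\eta:0\to1$, $\delta:1\to2$, $\epsilon:1\to0$ and the above equations, i.e. its morphisms are the terms built from the generators, identities and symmetries by composition and tensor product, modulo the smallest congruence containing the equations and the laws of a prop. Let $\mathbf{Rel}$ be the prop whose morphisms $m\to n$ are the binary relations from $\{0,\dots,m-1\}$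 to $\{0,\dots,n-1\}$, with relational composition, and with tensor product and symmetry given by disjoint union. Theorem. 1. $\mathbf{Rel}$ is equivalent, as a symmetric monoidal category, to the category of finite sets and relations with disjoint union as monoidal product. 2. $\mathbf{Th}$ is the prop for special bicommutative bimonoids: for every symmetric monoidal category $\mathcal C$, the category of algebras of $\mathbf{Th}$ in $\mathcal C$ (symmetric strong monoidal functors $\mathbf{Th}\to\mathcal C$ and monoidal natural transformations) is equivalent to the category of special bicommutative bimonoids in $\mathcal C$, by an equivalence compatible, up to natural isomorphism, with underlying objects ($F\mapsto F(1)$ on algebras); and if $\mathcal C$ is strict, the same holds for the category of strict algebras (symmetric strict monoidal functors). 3. $\mathbf{Rel}$ and $\mathbf{Th}$ are isomorphic as props. -/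

import Mathlib

open CategoryTheory MonoidalCategory

universe v u w

namespace SymMonTheory

/-! ### Props -/

/-- The operations of a prop: hom-sets indexed by pairs of natural numbers, identities,
composition (in diagrammatic order), the tensor product (which on objects is addition) and the
braiding. No laws are imposed yet. -/
structure PropData where
  Hom : ℕ → ℕ → Type w
  id (n : ℕ) : Hom n n
  comp {l m n : ℕ} : Hom l m → Hom m n → Hom l n
  tensor {m n p q : ℕ} : Hom m n → Hom p q → Hom (m + p) (n + q)
  braid (m n : ℕ) : Hom (m + n) (n + m)

/-- An equality of objects, regarded as an (identity) morphism. -/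
def PropData.eqHom (D : PropData.{w}) {m n : ℕ} (h : m = n) : D.Hom m n :=
  h ▸ D.id m

/-- A prop: a symmetric strict monoidal category whose objects are the natural numbers and whose
tensor product is addition on objects. Strictness means that the associator and the unitors
are the identities `eqHom`; the right unit law needs no `eqHom` as `n + 0` is `n` by definition. -/
structure PROP extends PropData.{w} where
  id_comp {m n : ℕ} (f : Hom m n) : comp (id m) f = f
  comp_id {m n : ℕ} (f : Hom m n) : comp f (id n) = f
  assoc {k l m n : ℕ} (f : Hom k l) (g : Hom l m) (h : Hom m n) :
    comp (comp f g) h = comp f (comp g h)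
  tensor_id (m n : ℕ) : tensor (id m) (id n) = id (m + n)
  tensor_comp {l m n p q r : ℕ} (f : Hom l m) (g : Hom m n) (f' : Hom p q) (g' : Hom q r) :
    tensor (comp f g) (comp f' g') = comp (tensor f f') (tensor g g')
  tensor_assoc {a b c a' b' c' : ℕ} (f : Hom a a') (g : Hom b b') (h : Hom c c') :
    comp (tensor (tensor f g) h) (toPropData.eqHom (Nat.add_assoc a' b' c')) =
      comp (toPropData.eqHom (Nat.add_assoc a b c)) (tensor f (tensor g h))
  id_zero_tensor {m n : ℕ} (f : Hom m n) :
    comp (tensor (id 0) f) (toPropData.eqHom (Nat.zero_add n)) =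
      comp (toPropData.eqHom (Nat.zero_add m)) f
  tensor_id_zero {m n : ℕ} (f : Hom m n) : tensor f (id 0) = f
  braid_natural {m n p q : ℕ} (f : Hom m n) (g : Hom p q) :
    comp (tensor f g) (braid n q) = comp (braid m p) (tensor g f)
  braid_symm (m n : ℕ) : comp (braid m n) (braid n m) = id (m + n)
  hexagon (m n p : ℕ) :
    comp (toPropData.eqHom (Nat.add_assoc m n p))
        (comp (braid m (n + p)) (toPropData.eqHom (Nat.add_assoc n p m))) =
      comp (tensor (braid m n) (id p))
        (comp (toPropData.eqHom (Nat.add_assoc n m p)) (tensor (id n) (braid m p)))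

namespace PROP

/-- A morphism of props: a symmetric strict monoidal functor which is the identity on objects. -/
@[ext]
structure Morphism (P Q : PROP.{w}) where
  map : ∀ {m n : ℕ}, P.Hom m n → Q.Hom m n
  map_id : ∀ n : ℕ, map (P.id n) = Q.id n
  map_comp : ∀ {l m n : ℕ} (f : P.Hom l m) (g : P.Hom m n),
    map (P.comp f g) = Q.comp (map f) (map g)
  map_tensor : ∀ {m n p q : ℕ} (f : P.Hom m n) (g : P.Hom p q),
    map (P.tensor f g) = Q.tensor (map f) (map g)
  map_braid : ∀ m n : ℕ, map (P.braid m n) = Q.braid m n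

/-- The category of props. -/
instance : Category PROP.{w} where
  Hom P Q := Morphism P Q
  id P := ⟨fun f => f, fun _ => rfl, fun _ _ => rfl, fun _ _ => rfl, fun _ _ => rfl⟩
  comp F G := ⟨fun f => G.map (F.map f), fun n => by rw [F.map_id, G.map_id],
    fun f g => by rw [F.map_comp, G.map_comp], fun f g => by rw [F.map_tensor, G.map_tensor],
    fun m n => by rw [F.map_braid, G.map_braid]⟩

variable (P : PROP.{w})

theorem eqHom_comp_eqHom {l m n : ℕ} (h : l = m) (h' : m = n) :
    P.comp (P.eqHom h) (P.eqHom h') = P.eqHom (h.trans h') := by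
  subst h; subst h'; exact P.id_comp _

theorem tensor_eqHom {m n p q : ℕ} (h : m = n) (h' : p = q) :
    P.tensor (P.eqHom h) (P.eqHom h') = P.eqHom (by rw [h, h'] : m + p = n + q) := by
  subst h; subst h'; exact P.tensor_id _ _

theorem tensor_id_eqHom (m : ℕ) {p q : ℕ} (h' : p = q) :
    P.tensor (P.id m) (P.eqHom h') = P.eqHom (by rw [h'] : m + p = m + q) :=
  P.tensor_eqHom rfl h'

theorem tensor_eqHom_id {m n : ℕ} (h : m = n) (p : ℕ) :
    P.tensor (P.eqHom h) (P.id p) = P.eqHom (by rw [h] : m + p = n + p) :=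
  P.tensor_eqHom h rfl

/-- The objects of the prop `P`, i.e. the natural numbers. -/
structure Ob (P : PROP.{w}) where
  val : ℕ

/-- The underlying category of a prop. -/
instance : Category.{w} P.Ob where
  Hom m n := P.Hom m.val n.val
  id m := P.id m.val
  comp f g := P.comp f g
  id_comp f := P.id_comp f
  comp_id f := P.comp_id f
  assoc f g h := P.assoc f g h

/-- An equality of objects, regarded as an isomorphism. -/
def eqIso {X Y : P.Ob} (h : X.val = Y.val) : X ≅ Y where
  hom := P.eqHom h
  inv := P.eqHom h.symm
  hom_inv_id := P.eqHom_comp_eqHom _ _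
  inv_hom_id := P.eqHom_comp_eqHom _ _

instance : MonoidalCategoryStruct P.Ob where
  tensorObj m n := ⟨m.val + n.val⟩
  tensorUnit := ⟨0⟩
  tensorHom {m n p q} f g :=
    (P.tensor (m := m.val) (n := n.val) (p := p.val) (q := q.val) f g :
      P.Hom (m.val + p.val) (n.val + q.val))
  whiskerLeft m {p q} g :=
    (P.tensor (P.id m.val) (p := p.val) (q := q.val) g : P.Hom (m.val + p.val) (m.val + q.val))
  whiskerRight {m n} f p :=
    (P.tensor (m := m.val) (n := n.val) f (P.id p.val) : P.Hom (m.val + p.val) (n.val + p.val))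
  associator a b c := P.eqIso (Nat.add_assoc a.val b.val c.val)
  leftUnitor a := P.eqIso (Nat.zero_add a.val)
  rightUnitor a := P.eqIso (Nat.add_zero a.val)

/-- The (strict) monoidal structure of a prop. -/
instance : MonoidalCategory P.Ob :=
  MonoidalCategory.ofTensorHom
    (id_tensorHom_id := fun m n => P.tensor_id m.val n.val)
    (id_tensorHom := fun _ _ _ _ => rfl)
    (tensorHom_id := fun _ _ => rfl)
    (tensorHom_comp_tensorHom := fun f₁ f₂ g₁ g₂ => (P.tensor_comp f₁ g₁ f₂ g₂).symm)
    (associator_naturality := fun f g h => P.tensor_assoc f g h)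
    (leftUnitor_naturality := fun f => P.id_zero_tensor f)
    (rightUnitor_naturality := fun f =>
      ((P.comp_id _).trans (P.tensor_id_zero f)).trans (P.id_comp f).symm)
    (pentagon := fun a b c d => by
      change P.comp (P.tensor (P.eqHom _) (P.id _)) (P.comp (P.eqHom _)
        (P.tensor (P.id _) (P.eqHom _))) = P.comp (P.eqHom _) (P.eqHom _)
      rw [tensor_id_eqHom, tensor_eqHom_id, eqHom_comp_eqHom]
      erw [eqHom_comp_eqHom, eqHom_comp_eqHom])
    (triangle := fun a b => by
      change P.comp (P.eqHom (Nat.add_assoc a.val 0 b.val))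
        (P.tensor (P.id a.val) (P.eqHom (Nat.zero_add b.val))) =
          P.tensor (P.eqHom (Nat.add_zero a.val)) (P.id b.val)
      rw [tensor_id_eqHom, tensor_eqHom_id]
      erw [eqHom_comp_eqHom])

/-- The braiding of a prop, as an isomorphism. -/
def braidIso (X Y : P.Ob) : X ⊗ Y ≅ Y ⊗ X where
  hom := P.braid X.val Y.val
  inv := P.braid Y.val X.val
  hom_inv_id := P.braid_symm _ _
  inv_hom_id := P.braid_symm _ _

theorem braidIso_hexagon (X Y Z : P.Ob) :
    (α_ X Y Z).hom ≫ (P.braidIso X (Y ⊗ Z)).hom ≫ (α_ Y Z X).hom =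
      ((P.braidIso X Y).hom ▷ Z) ≫ (α_ Y X Z).hom ≫ (Y ◁ (P.braidIso X Z).hom) :=
  P.hexagon X.val Y.val Z.val

/-- The symmetry of a prop. -/
instance : SymmetricCategory P.Ob where
  braiding X Y := P.braidIso X Y
  braiding_naturality_right X _ _ f := P.braid_natural (P.id X.val) f
  braiding_naturality_left f Z := P.braid_natural f (P.id Z.val)
  hexagon_forward X Y Z := P.braidIso_hexagon X Y Z
  hexagon_reverse X Y Z := by
    have h : (α_ Z X Y ≪≫ P.braidIso Z (X ⊗ Y) ≪≫ α_ X Y Z) =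
        (whiskerRightIso (P.braidIso Z X) Y ≪≫ α_ X Z Y ≪≫ whiskerLeftIso X (P.braidIso Z Y)) :=
      Iso.ext (P.braidIso_hexagon Z X Y)
    have h' := congrArg Iso.inv h
    simp only [Iso.trans_inv, Category.assoc] at h'
    exact h'
  symmetry m n := P.braid_symm m.val n.val

end PROP

/-! ### Quotients by generated congruences -/

/-- The smallest congruence (for composition and tensor product) on `D` which contains `E` and
the laws of a prop. -/
inductive PropData.Cong (D : PropData.{w}) (E : ∀ {m n : ℕ}, D.Hom m n → D.Hom m n → Prop) :
    ∀ {m n : ℕ}, D.Hom m n → D.Hom m n → Prop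
  | of {m n : ℕ} {f g : D.Hom m n} : E f g → Cong D E f g
  | refl {m n : ℕ} (f : D.Hom m n) : Cong D E f f
  | symm {m n : ℕ} {f g : D.Hom m n} : Cong D E f g → Cong D E g f
  | trans {m n : ℕ} {f g h : D.Hom m n} : Cong D E f g → Cong D E g h → Cong D E f h
  | comp_congr {l m n : ℕ} {f f' : D.Hom l m} {g g' : D.Hom m n} :
      Cong D E f f' → Cong D E g g' → Cong D E (D.comp f g) (D.comp f' g')
  | tensor_congr {m n p q : ℕ} {f f' : D.Hom m n} {g g' : D.Hom p q} :
      Cong D E f f' → Cong D E g g' → Cong D E (D.tensor f g) (D.tensor f' g')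
  | id_comp {m n : ℕ} (f : D.Hom m n) : Cong D E (D.comp (D.id m) f) f
  | comp_id {m n : ℕ} (f : D.Hom m n) : Cong D E (D.comp f (D.id n)) f
  | assoc {k l m n : ℕ} (f : D.Hom k l) (g : D.Hom l m) (h : D.Hom m n) :
      Cong D E (D.comp (D.comp f g) h) (D.comp f (D.comp g h))
  | tensor_id (m n : ℕ) : Cong D E (D.tensor (D.id m) (D.id n)) (D.id (m + n))
  | tensor_comp {l m n p q r : ℕ} (f : D.Hom l m) (g : D.Hom m n) (f' : D.Hom p q)
      (g' : D.Hom q r) :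
      Cong D E (D.tensor (D.comp f g) (D.comp f' g')) (D.comp (D.tensor f f') (D.tensor g g'))
  | tensor_assoc {a b c a' b' c' : ℕ} (f : D.Hom a a') (g : D.Hom b b') (h : D.Hom c c') :
      Cong D E (D.comp (D.tensor (D.tensor f g) h) (D.eqHom (Nat.add_assoc a' b' c')))
        (D.comp (D.eqHom (Nat.add_assoc a b c)) (D.tensor f (D.tensor g h)))
  | id_zero_tensor {m n : ℕ} (f : D.Hom m n) :
      Cong D E (D.comp (D.tensor (D.id 0) f) (D.eqHom (Nat.zero_add n)))
        (D.comp (D.eqHom (Nat.zero_add m)) f)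
  | tensor_id_zero {m n : ℕ} (f : D.Hom m n) : Cong D E (D.tensor f (D.id 0)) f
  | braid_natural {m n p q : ℕ} (f : D.Hom m n) (g : D.Hom p q) :
      Cong D E (D.comp (D.tensor f g) (D.braid n q)) (D.comp (D.braid m p) (D.tensor g f))
  | braid_symm (m n : ℕ) : Cong D E (D.comp (D.braid m n) (D.braid n m)) (D.id (m + n))
  | hexagon (m n p : ℕ) :
      Cong D E
        (D.comp (D.eqHom (Nat.add_assoc m n p))
          (D.comp (D.braid m (n + p)) (D.eqHom (Nat.add_assoc n p m))))
        (D.comp (D.tensor (D.braid m n) (D.id p))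
          (D.comp (D.eqHom (Nat.add_assoc n m p)) (D.tensor (D.id n) (D.braid m p))))

/-- The operations induced on the quotient of `D` by the congruence `D.Cong E`. -/
def PropData.quotData (D : PropData.{w})
    (E : ∀ {m n : ℕ}, D.Hom m n → D.Hom m n → Prop) : PropData.{w} where
  Hom m n := Quot (D.Cong E (m := m) (n := n))
  id n := Quot.mk _ (D.id n)
  comp := Quot.map₂ D.comp (fun a _ _ h => .comp_congr (.refl a) h)
    (fun _ _ b h => .comp_congr h (.refl b))
  tensor := Quot.map₂ D.tensor (fun a _ _ h => .tensor_congr (.refl a) h)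
    (fun _ _ b h => .tensor_congr h (.refl b))
  braid m n := Quot.mk _ (D.braid m n)

theorem PropData.quotData_eqHom (D : PropData.{w})
    (E : ∀ {m n : ℕ}, D.Hom m n → D.Hom m n → Prop) {m n : ℕ} (h : m = n) :
    (D.quotData E).eqHom h = Quot.mk _ (D.eqHom h) := by
  subst h; rfl

/-- The prop obtained from `D` by dividing out the congruence generated by `E` and by the laws
of a prop. -/
def PropData.quotient (D : PropData.{w})
    (E : ∀ {m n : ℕ}, D.Hom m n → D.Hom m n → Prop) : PROP.{w} where
  toPropData := D.quotData E
  id_comp := by rintro m n ⟨f⟩; exact Quot.sound (.id_comp f)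
  comp_id := by rintro m n ⟨f⟩; exact Quot.sound (.comp_id f)
  assoc := by rintro k l m n ⟨f⟩ ⟨g⟩ ⟨h⟩; exact Quot.sound (.assoc f g h)
  tensor_id m n := Quot.sound (.tensor_id m n)
  tensor_comp := by
    rintro l m n p q r ⟨f⟩ ⟨g⟩ ⟨f'⟩ ⟨g'⟩; exact Quot.sound (.tensor_comp f g f' g')
  tensor_assoc := by
    rintro a b c a' b' c' ⟨f⟩ ⟨g⟩ ⟨h⟩
    rw [D.quotData_eqHom E, D.quotData_eqHom E]
    exact Quot.sound (.tensor_assoc f g h)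
  id_zero_tensor := by
    rintro m n ⟨f⟩
    rw [D.quotData_eqHom E, D.quotData_eqHom E]
    exact Quot.sound (.id_zero_tensor f)
  tensor_id_zero := by rintro m n ⟨f⟩; exact Quot.sound (.tensor_id_zero f)
  braid_natural := by rintro m n p q ⟨f⟩ ⟨g⟩; exact Quot.sound (.braid_natural f g)
  braid_symm m n := Quot.sound (.braid_symm m n)
  hexagon m n p := by
    rw [D.quotData_eqHom E, D.quotData_eqHom E, D.quotData_eqHom E]
    exact Quot.sound (.hexagon m n p)

/-! ### Symmetric monoidal theories -/

/-- The terms over a signature `Gen`, where `Gen m n` is the set of generators `m → n`.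
Identities and braidings of all arities are included as basic terms; composition is written in
diagrammatic order. -/
inductive Term (Gen : ℕ → ℕ → Type w) : ℕ → ℕ → Type w
  | gen {m n : ℕ} (σ : Gen m n) : Term Gen m n
  | id (n : ℕ) : Term Gen n n
  | braid (m n : ℕ) : Term Gen (m + n) (n + m)
  | comp {l m n : ℕ} (s : Term Gen l m) (t : Term Gen m n) : Term Gen l n
  | tensor {m n p q : ℕ} (s : Term Gen m n) (t : Term Gen p q) : Term Gen (m + p) (n + q)

/-- The terms over a signature with their (formal) operations. -/
def termData (Gen : ℕ → ℕ → Type w) : PropData.{w} where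
  Hom := Term Gen
  id := .id
  comp := .comp
  tensor := .tensor
  braid := .braid

/-- A symmetric monoidal theory: a signature and a set of equations, an equation being a pair of
terms of the same type. -/
structure Theory where
  Gen : ℕ → ℕ → Type w
  Eqn : ∀ {m n : ℕ}, Term Gen m n → Term Gen m n → Prop

/-- The prop presented by a theory: terms modulo the laws of a prop and the equations of the
theory. -/
def Theory.prop (T : Theory.{w}) : PROP.{w} :=
  (termData T.Gen).quotient T.Eqn

section Models

variable {C : Type u} [Category.{v} C] [MonoidalCategory C]

/-- The tensor power `X^{⊗ n}`, bracketed to the left. -/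
def pow (X : C) : ℕ → C
  | 0 => 𝟙_ C
  | n + 1 => pow X n ⊗ X

/-- The tensor power `f^{⊗ n}` of a morphism. -/
def powMap {X Y : C} (f : X ⟶ Y) : ∀ n : ℕ, pow X n ⟶ pow Y n
  | 0 => 𝟙 (𝟙_ C)
  | n + 1 => powMap f n ⊗ₘ f

/-- The canonical isomorphism `X^{⊗ (m + n)} ≅ X^{⊗ m} ⊗ X^{⊗ n}`. -/
def powAdd (X : C) (m : ℕ) : ∀ n : ℕ, pow X (m + n) ≅ pow X m ⊗ pow X n
  | 0 => (ρ_ (pow X m)).symm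
  | n + 1 => whiskerRightIso (powAdd X m n) X ≪≫ α_ (pow X m) (pow X n) X

/-- The interpretation of a term in a symmetric monoidal category, given the interpretation of
the generators. -/
def Term.eval [SymmetricCategory C] {Gen : ℕ → ℕ → Type w} (X : C)
    (op : ∀ {m n : ℕ}, Gen m n → (pow X m ⟶ pow X n)) :
    ∀ {m n : ℕ}, Term Gen m n → (pow X m ⟶ pow X n)
  | _, _, .gen σ => op σ
  | _, _, .id n => 𝟙 (pow X n)
  | _, _, .braid m n =>
      (powAdd X m n).hom ≫ (β_ (pow X m) (pow X n)).hom ≫ (powAdd X n m).inv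
  | _, _, .comp s t => s.eval X op ≫ t.eval X op
  | _, _, .tensor (m := m) (n := n) (p := p) (q := q) s t =>
      (powAdd X m p).hom ≫ (s.eval X op ⊗ₘ t.eval X op) ≫ (powAdd X n q).inv

variable (C) in
/-- A model of a theory in a symmetric monoidal category. -/
structure Model (T : Theory.{w}) [SymmetricCategory C] where
  X : C
  op : ∀ {m n : ℕ}, T.Gen m n → (pow X m ⟶ pow X n)
  sat : ∀ {m n : ℕ} {s t : Term T.Gen m n}, T.Eqn s t → s.eval X op = t.eval X op

theorem powMap_id (X : C) : ∀ n : ℕ, powMap (𝟙 X) n = 𝟙 (pow X n)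
  | 0 => rfl
  | n + 1 => by simp [powMap, pow, powMap_id X n]

theorem powMap_comp {X Y Z : C} (f : X ⟶ Y) (g : Y ⟶ Z) :
    ∀ n : ℕ, powMap (f ≫ g) n = powMap f n ≫ powMap g n
  | 0 => (Category.comp_id _).symm
  | n + 1 => by
    simp only [powMap, powMap_comp f g n]
    exact (MonoidalCategory.tensorHom_comp_tensorHom _ _ _ _).symm

variable [SymmetricCategory C]

/-- A morphism of models: a morphism of the underlying objects commuting with the operations. -/
@[ext]
structure Model.Hom {T : Theory.{w}} (M N : Model C T) where
  hom : M.X ⟶ N.X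
  comm : ∀ {m n : ℕ} (σ : T.Gen m n), M.op σ ≫ powMap hom n = powMap hom m ≫ N.op σ

/-- The category of models of a theory. -/
instance (T : Theory.{w}) : Category (Model C T) where
  Hom := Model.Hom
  id M := ⟨𝟙 M.X, fun σ => by simp [powMap_id]⟩
  comp f g := ⟨f.hom ≫ g.hom, fun σ => by
    rw [powMap_comp, powMap_comp, ← Category.assoc, f.comm, Category.assoc, g.comm,
      Category.assoc]⟩
  id_comp f := Model.Hom.ext (Category.id_comp f.hom)
  comp_id f := Model.Hom.ext (Category.comp_id f.hom)
  assoc f g h := Model.Hom.ext (Category.assoc f.hom g.hom h.hom)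

variable (C) in
/-- The underlying object of a model. -/
def Model.forget (T : Theory.{w}) : Model C T ⥤ C where
  obj M := M.X
  map f := Model.Hom.hom f

end Models

/-! ### Algebras of a prop -/

section Algebras

/-- A monoidal category is strict if its associator and unitors are identities. -/
class IsStrict (C : Type u) [Category.{v} C] [MonoidalCategory C] : Prop where
  associator (X Y Z : C) : ∃ h : (X ⊗ Y) ⊗ Z = X ⊗ (Y ⊗ Z), (α_ X Y Z).hom = eqToHom h
  leftUnitor (X : C) : ∃ h : 𝟙_ C ⊗ X = X, (λ_ X).hom = eqToHom h
  rightUnitor (X : C) : ∃ h : X ⊗ 𝟙_ C = X, (ρ_ X).hom = eqToHom h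

variable (P : PROP.{w}) (C : Type u) [Category.{v} C] [MonoidalCategory C] [SymmetricCategory C]

/-- An algebra of a prop in a symmetric monoidal category: a symmetric (strong) monoidal
functor. -/
structure Algebra where
  functor : P.Ob ⥤ C
  [braided : functor.Braided]

attribute [instance] Algebra.braided

variable {P C}

/-- A morphism of algebras: a monoidal natural transformation. -/
@[ext]
structure Algebra.Hom (F G : Algebra P C) where
  trans : F.functor ⟶ G.functor
  [isMonoidal : NatTrans.IsMonoidal trans]

attribute [instance] Algebra.Hom.isMonoidal

/-- The category of algebras of a prop. -/
instance : Category (Algebra P C) where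
  Hom := Algebra.Hom
  id F := ⟨𝟙 F.functor⟩
  comp f g := ⟨f.trans ≫ g.trans⟩
  id_comp f := Algebra.Hom.ext (Category.id_comp f.trans)
  comp_id f := Algebra.Hom.ext (Category.comp_id f.trans)
  assoc f g h := Algebra.Hom.ext (Category.assoc f.trans g.trans h.trans)

variable (P C)

/-- The underlying object of an algebra: its value at the generating object `1`. -/
def Algebra.evalOne : Algebra P C ⥤ C where
  obj F := F.functor.obj ⟨1⟩
  map f := (Algebra.Hom.trans f).app ⟨1⟩

open Functor.LaxMonoidal in
/-- An algebra is strict if the structure morphisms of its functor are identities. -/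
def Algebra.isStrict : ObjectProperty (Algebra P C) := fun F =>
  (∃ h : 𝟙_ C = F.functor.obj (𝟙_ P.Ob), ε F.functor = eqToHom h) ∧
    ∀ X Y : P.Ob, ∃ h : F.functor.obj X ⊗ F.functor.obj Y = F.functor.obj (X ⊗ Y),
      μ F.functor X Y = eqToHom h

end Algebras

/-- `P` is the prop for the theory `T`: in every symmetric monoidal category `C`, the category of
algebras of `P` is equivalent to the category of models of `T`, compatibly with underlying
objects; and when `C` is strict, so is the category of strict algebras of `P`. -/
def IsPropFor (P : PROP.{w}) (T : Theory.{w}) : Prop :=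
  ∀ (C : Type u) [Category.{v} C] [MonoidalCategory C] [SymmetricCategory C],
    (∃ E : Algebra P C ≌ Model C T,
      Nonempty (E.functor ⋙ Model.forget C T ≅ Algebra.evalOne P C)) ∧
    (IsStrict C → ∃ E : (Algebra.isStrict P C).FullSubcategory ≌ Model C T,
      Nonempty (E.functor ⋙ Model.forget C T ≅
        (Algebra.isStrict P C).ι ⋙ Algebra.evalOne P C))

/-! ### The theory of special bicommutative bimonoids -/

namespace SBB

/-- The generators of the theory of bimonoids. -/
inductive Gen : ℕ → ℕ → Type
  | mul : Gen 2 1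
  | unit : Gen 0 1
  | comul : Gen 1 2
  | counit : Gen 1 0

/-- The multiplication `μ : 2 → 1`. -/
abbrev mul : Term Gen 2 1 := .gen .mul

/-- The unit `η : 0 → 1`. -/
abbrev unit : Term Gen 0 1 := .gen .unit

/-- The comultiplication `δ : 1 → 2`. -/
abbrev comul : Term Gen 1 2 := .gen .comul

/-- The counit `ε : 1 → 0`. -/
abbrev counit : Term Gen 1 0 := .gen .counit

/-- The identity `1 → 1`. -/
abbrev one : Term Gen 1 1 := .id 1

/-- The braiding `2 → 2`. -/
abbrev swap : Term Gen 2 2 := .braid 1 1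

/-- The braiding of the two middle strands, `4 → 4`. -/
abbrev exch : Term Gen 4 4 :=
  .tensor (m := 1) (n := 1) (p := 3) (q := 3) one (.tensor (m := 2) (n := 2) swap one)

/-- The equations of the theory of special bicommutative bimonoids. -/
inductive Eqn : ∀ {m n : ℕ}, Term Gen m n → Term Gen m n → Prop
  -- commutative monoid
  | assoc : Eqn (m := 3) (n := 1) (.comp (.tensor mul one) mul) (.comp (.tensor one mul) mul)
  | unit_left : Eqn (m := 1) (n := 1) (.comp (.tensor unit one) mul) one
  | comm : Eqn (m := 2) (n := 1) (.comp swap mul) mul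
  -- cocommutative comonoid
  | coassoc : Eqn (m := 1) (n := 3) (.comp comul (.tensor comul one))
      (.comp comul (.tensor one comul))
  | counit_left : Eqn (m := 1) (n := 1) (.comp comul (.tensor counit one)) one
  | cocomm : Eqn (m := 1) (n := 2) (.comp comul swap) comul
  -- bimonoid laws
  | mul_comul : Eqn (m := 2) (n := 2) (.comp mul comul)
      (.comp (.tensor comul comul) (.comp exch (.tensor mul mul)))
  | mul_counit : Eqn (m := 2) (n := 0) (.comp mul counit) (.tensor counit counit)
  | unit_comul : Eqn (m := 0) (n := 2) (.comp unit comul) (.tensor unit unit)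
  -- extra law
  | extra : Eqn (m := 0) (n := 0) (.comp unit counit) (.id 0)
  -- special law
  | special : Eqn (m := 1) (n := 1) (.comp comul mul) one

end SBB

/-- The symmetric monoidal theory of special bicommutative bimonoids. -/
def sbb : Theory.{0} where
  Gen := SBB.Gen
  Eqn := SBB.Eqn

/-! ### Finite sets and relations -/

section LiftRel

variable {α β γ α' β' γ' α'' β'' : Type} {r : α → α' → Prop} {s : β → β' → Prop}
  {t : γ → γ' → Prop} {r' : α' → α'' → Prop} {s' : β' → β'' → Prop}

theorem liftRel_eq (x y : α ⊕ β) : Sum.LiftRel (· = ·) (· = ·) x y ↔ x = y := by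
  rcases x with x | x <;> rcases y with y | y <;> simp

theorem liftRel_comp (x : α ⊕ β) (y : α'' ⊕ β'') :
    Relation.Comp (Sum.LiftRel r s) (Sum.LiftRel r' s') x y ↔
      Sum.LiftRel (Relation.Comp r r') (Relation.Comp s s') x y := by
  rcases x with x | x <;> rcases y with y | y <;> simp [Relation.Comp]

theorem liftRel_assoc (x : (α ⊕ β) ⊕ γ) (y : α' ⊕ (β' ⊕ γ')) :
    Sum.LiftRel (Sum.LiftRel r s) t x ((Equiv.sumAssoc α' β' γ').symm y) ↔
      Sum.LiftRel r (Sum.LiftRel s t) (Equiv.sumAssoc α β γ x) y := by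
  rcases x with (x | x) | x <;> rcases y with y | y | y <;> simp

theorem liftRel_empty_left (q : Empty → Empty → Prop) (x : Empty ⊕ α) (y : α') :
    Sum.LiftRel q r x ((Equiv.emptySum Empty α').symm y) ↔ r (Equiv.emptySum Empty α x) y := by
  rcases x with x | x
  · exact x.elim
  · simp

theorem liftRel_empty_right (q : Empty → Empty → Prop) (x : α ⊕ Empty) (y : α') :
    Sum.LiftRel r q x ((Equiv.sumEmpty α' Empty).symm y) ↔ r (Equiv.sumEmpty α Empty x) y := by
  rcases x with x | x
  · simp
  · exact x.elim

theorem liftRel_swap (x : α ⊕ β) (y : β' ⊕ α') :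
    Sum.LiftRel r s x ((Equiv.sumComm α' β').symm y) ↔
      Sum.LiftRel s r (Equiv.sumComm α β x) y := by
  rcases x with x | x <;> rcases y with y | y <;> simp

theorem liftRel_graph (e : α ≃ α') (e' : β ≃ β') (x : α ⊕ β) (y : α' ⊕ β') :
    Sum.LiftRel (fun a b => e a = b) (fun a b => e' a = b) x y ↔ e.sumCongr e' x = y := by
  rcases x with x | x <;> rcases y with y | y <;> simp

end LiftRel

/-- A finite set, as an object of the category of finite sets and relations. -/
structure FinRel where
  carrier : Type
  [finite : Finite carrier]

attribute [instance] FinRel.finite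

namespace FinRel

/-- The category of finite sets and binary relations. -/
instance : Category FinRel where
  Hom X Y := X.carrier → Y.carrier → Prop
  id _ := fun x y => x = y
  comp R S := Relation.Comp R S
  id_comp _ := Relation.eq_comp
  comp_id _ := Relation.comp_eq
  assoc _ _ _ := Relation.comp_assoc

/-- The graph of a bijection, as an isomorphism in the category of relations. -/
def graphIso {X Y : FinRel} (e : X.carrier ≃ Y.carrier) : X ≅ Y where
  hom := fun x y => e x = y
  inv := fun y x => e.symm y = x
  hom_inv_id := by
    funext x y
    simp [CategoryStruct.comp, CategoryStruct.id, Relation.Comp]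
  inv_hom_id := by
    funext x y
    simp [CategoryStruct.comp, CategoryStruct.id, Relation.Comp]

instance : MonoidalCategoryStruct FinRel where
  tensorObj X Y := ⟨X.carrier ⊕ Y.carrier⟩
  tensorUnit := ⟨Empty⟩
  tensorHom R S := Sum.LiftRel R S
  whiskerLeft _ _ _ S := Sum.LiftRel (· = ·) S
  whiskerRight R _ := Sum.LiftRel R (· = ·)
  associator X Y Z := graphIso (Equiv.sumAssoc X.carrier Y.carrier Z.carrier)
  leftUnitor X := graphIso (Equiv.emptySum Empty X.carrier)
  rightUnitor X := graphIso (Equiv.sumEmpty X.carrier Empty)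

theorem hom_ext {X Y : FinRel} {R S : X ⟶ Y} (h : ∀ x y, R x y ↔ S x y) : R = S :=
  funext fun x => funext fun y => propext (h x y)

theorem comp_graphIso {X Y Z : FinRel} (R : X ⟶ Y) (e : Y.carrier ≃ Z.carrier)
    (x : X.carrier) (z : Z.carrier) : (R ≫ (graphIso e).hom) x z ↔ R x (e.symm z) :=
  ⟨fun ⟨y, h, h'⟩ => by
    have h' : e y = z := h'
    subst h'; simpa using h, fun h => ⟨e.symm z, h, e.apply_symm_apply z⟩⟩

theorem graphIso_comp {X Y Z : FinRel} (e : X.carrier ≃ Y.carrier) (R : Y ⟶ Z)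
    (x : X.carrier) (z : Z.carrier) : ((graphIso e).hom ≫ R) x z ↔ R (e x) z :=
  ⟨fun ⟨y, h, h'⟩ => by
    have h : e x = y := h
    subst h; exact h', fun h => ⟨e x, rfl, h⟩⟩

theorem natural_of {X Y Z W : FinRel} (e : X.carrier ≃ Y.carrier) (e' : Z.carrier ≃ W.carrier)
    (R : X ⟶ Z) (S : Y ⟶ W) (h : ∀ x w, R x (e'.symm w) ↔ S (e x) w) :
    R ≫ (graphIso e').hom = (graphIso e).hom ≫ S :=
  hom_ext fun x w =>
    (comp_graphIso R e' x w).trans ((h x w).trans (graphIso_comp e S x w).symm)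

theorem graphIso_comp_graphIso {X Y Z : FinRel} (e : X.carrier ≃ Y.carrier)
    (e' : Y.carrier ≃ Z.carrier) :
    (graphIso e).hom ≫ (graphIso e').hom = (graphIso (e.trans e')).hom :=
  hom_ext fun x z => graphIso_comp e _ x z

theorem tensor_graphIso {X Y Z W : FinRel} (e : X.carrier ≃ Y.carrier)
    (e' : Z.carrier ≃ W.carrier) :
    ((graphIso e).hom ⊗ₘ (graphIso e').hom) =
      (graphIso (X := X ⊗ Z) (Y := Y ⊗ W) (e.sumCongr e')).hom :=
  hom_ext fun a b => liftRel_graph e e' a b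

theorem tensor_graphIso_id {X Y : FinRel} (e : X.carrier ≃ Y.carrier) (Z : FinRel) :
    ((graphIso e).hom ⊗ₘ 𝟙 Z) =
      (graphIso (X := X ⊗ Z) (Y := Y ⊗ Z) (e.sumCongr (Equiv.refl _))).hom :=
  tensor_graphIso e (Equiv.refl _)

theorem tensor_id_graphIso {X Y : FinRel} (e : X.carrier ≃ Y.carrier) (Z : FinRel) :
    (𝟙 Z ⊗ₘ (graphIso e).hom) =
      (graphIso (X := Z ⊗ X) (Y := Z ⊗ Y) ((Equiv.refl _).sumCongr e)).hom :=
  tensor_graphIso (Equiv.refl _) e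

theorem graphIso_congr {X Y : FinRel} {e e' : X.carrier ≃ Y.carrier} (h : ∀ x, e x = e' x) :
    (graphIso e).hom = (graphIso e').hom := by
  rw [Equiv.ext h]

/-- The monoidal structure given by disjoint union. -/
instance : MonoidalCategory FinRel :=
  MonoidalCategory.ofTensorHom
    (id_tensorHom_id := fun _ _ => hom_ext fun a b => liftRel_eq a b)
    (id_tensorHom := fun _ _ _ _ => rfl)
    (tensorHom_id := fun _ _ => rfl)
    (tensorHom_comp_tensorHom := fun _ _ _ _ => hom_ext fun a b => liftRel_comp a b)
    (associator_naturality := fun _ _ _ => natural_of _ _ _ _ fun x w => liftRel_assoc x w)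
    (leftUnitor_naturality := fun _ => natural_of _ _ _ _ fun x w => liftRel_empty_left _ x w)
    (rightUnitor_naturality := fun _ => natural_of _ _ _ _ fun x w => liftRel_empty_right _ x w)
    (pentagon := fun a b c d => by
      refine (congrArg₂ (· ≫ ·) (tensor_graphIso_id _ _)
        (congrArg₂ (· ≫ ·) rfl (tensor_id_graphIso _ _))).trans ?_
      refine (congrArg₂ (· ≫ ·) rfl (graphIso_comp_graphIso _ _)).trans ?_
      refine (graphIso_comp_graphIso _ _).trans (Eq.trans ?_ (graphIso_comp_graphIso _ _).symm)
      exact graphIso_congr (by rintro (((x | x) | x) | x) <;> rfl))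
    (triangle := fun a b => by
      refine (congrArg₂ (· ≫ ·) rfl (tensor_id_graphIso _ _)).trans ?_
      refine (graphIso_comp_graphIso _ _).trans (Eq.trans ?_ (tensor_graphIso_id _ _).symm)
      exact graphIso_congr (by
        rintro ((x | x) | x)
        · rfl
        · exact x.elim
        · rfl))

/-- The exchange of the two summands of a disjoint union. -/
def swapIso (X Y : FinRel) : X ⊗ Y ≅ Y ⊗ X :=
  graphIso (X := X ⊗ Y) (Y := Y ⊗ X) (Equiv.sumComm X.carrier Y.carrier)

theorem swapIso_symmetry (X Y : FinRel) :
    (swapIso X Y).hom ≫ (swapIso Y X).hom = 𝟙 (X ⊗ Y) :=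
  (graphIso_comp_graphIso _ _).trans
    (graphIso_congr (e' := Equiv.refl _) (by rintro (x | x) <;> rfl))

theorem swapIso_hexagon (X Y Z : FinRel) :
    (α_ X Y Z).hom ≫ (swapIso X (Y ⊗ Z)).hom ≫ (α_ Y Z X).hom =
      ((swapIso X Y).hom ▷ Z) ≫ (α_ Y X Z).hom ≫ (Y ◁ (swapIso X Z).hom) := by
  refine (congrArg₂ (· ≫ ·) rfl (graphIso_comp_graphIso _ _)).trans ?_
  refine (graphIso_comp_graphIso _ _).trans (Eq.symm ?_)
  refine (congrArg₂ (· ≫ ·) (tensor_graphIso_id _ _)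
    (congrArg₂ (· ≫ ·) rfl (tensor_id_graphIso _ _))).trans ?_
  refine (congrArg₂ (· ≫ ·) rfl (graphIso_comp_graphIso _ _)).trans ?_
  refine (graphIso_comp_graphIso _ _).trans ?_
  exact graphIso_congr (by rintro ((x | x) | x) <;> rfl)

/-- The symmetry exchanging the two summands of a disjoint union. -/
instance : SymmetricCategory FinRel where
  braiding := swapIso
  braiding_naturality_right _ _ _ _ := natural_of _ _ _ _ fun x w => liftRel_swap x w
  braiding_naturality_left _ _ := natural_of _ _ _ _ fun x w => liftRel_swap x w
  hexagon_forward := swapIso_hexagon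
  hexagon_reverse X Y Z := by
    have h : (α_ Z X Y ≪≫ swapIso Z (X ⊗ Y) ≪≫ α_ X Y Z) =
        (whiskerRightIso (swapIso Z X) Y ≪≫ α_ X Z Y ≪≫ whiskerLeftIso X (swapIso Z Y)) :=
      Iso.ext (swapIso_hexagon Z X Y)
    have h' := congrArg Iso.inv h
    simp only [Iso.trans_inv, Category.assoc] at h'
    exact h'
  symmetry := swapIso_symmetry

end FinRel

/-! ### The prop of relations -/

namespace RelProp

/-- Relations between the finite sets `Fin m`, with relational composition; the tensor product and
the braiding are those of disjoint unions, under `Fin m ⊕ Fin n ≃ Fin (m + n)`. -/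
def data : PropData.{0} where
  Hom m n := Fin m → Fin n → Prop
  id _ := fun i j => i = j
  comp R S := Relation.Comp R S
  tensor R S := fun i j => Sum.LiftRel R S (finSumFinEquiv.symm i) (finSumFinEquiv.symm j)
  braid _ _ := fun i j => (finSumFinEquiv.symm i).swap = finSumFinEquiv.symm j

theorem hom_ext {m n : ℕ} {R S : data.Hom m n} (h : ∀ x y, R x y ↔ S x y) : R = S :=
  funext fun x => funext fun y => propext (h x y)

theorem eqHom_comp {l m n : ℕ} (h : l = m) (R : data.Hom m n) (i : Fin l) (j : Fin n) :
    data.comp (data.eqHom h) R i j ↔ R (Fin.cast h i) j := by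
  subst h
  exact iff_of_eq (congrFun (congrFun (Relation.eq_comp (r := R)) i) j)

theorem comp_eqHom {l m n : ℕ} (h : m = n) (R : data.Hom l m) (i : Fin l) (j : Fin n) :
    data.comp R (data.eqHom h) i j ↔ R i (Fin.cast h.symm j) := by
  subst h
  exact iff_of_eq (congrFun (congrFun (Relation.comp_eq (r := R)) i) j)

theorem tensor_iff {m n p q : ℕ} (R : data.Hom m n) (S : data.Hom p q) (i : Fin (m + p))
    (j : Fin (n + q)) : data.tensor R S i j ↔
      Sum.LiftRel R S (finSumFinEquiv.symm i) (finSumFinEquiv.symm j) := Iff.rfl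

theorem tensor_ll {m n p q : ℕ} (R : data.Hom m n) (S : data.Hom p q) (i : Fin m) (j : Fin n) :
    data.tensor R S (Fin.castAdd p i) (Fin.castAdd q j) ↔ R i j := by
  rw [tensor_iff, finSumFinEquiv_symm_apply_castAdd,
    finSumFinEquiv_symm_apply_castAdd]
  exact Sum.liftRel_inl_inl

theorem tensor_lr {m n p q : ℕ} (R : data.Hom m n) (S : data.Hom p q) (i : Fin m) (j : Fin q) :
    data.tensor R S (Fin.castAdd p i) (Fin.natAdd n j) ↔ False := by
  rw [tensor_iff, finSumFinEquiv_symm_apply_castAdd,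
    finSumFinEquiv_symm_apply_natAdd]
  exact iff_false_intro Sum.not_liftRel_inl_inr

theorem tensor_rl {m n p q : ℕ} (R : data.Hom m n) (S : data.Hom p q) (i : Fin p) (j : Fin n) :
    data.tensor R S (Fin.natAdd m i) (Fin.castAdd q j) ↔ False := by
  rw [tensor_iff, finSumFinEquiv_symm_apply_natAdd,
    finSumFinEquiv_symm_apply_castAdd]
  exact iff_false_intro Sum.not_liftRel_inr_inl

theorem tensor_rr {m n p q : ℕ} (R : data.Hom m n) (S : data.Hom p q) (i : Fin p) (j : Fin q) :
    data.tensor R S (Fin.natAdd m i) (Fin.natAdd n j) ↔ S i j := by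
  rw [tensor_iff, finSumFinEquiv_symm_apply_natAdd,
    finSumFinEquiv_symm_apply_natAdd]
  exact Sum.liftRel_inr_inr

theorem comp_braid {l m n : ℕ} (R : data.Hom l (m + n)) (i : Fin l) (j : Fin (n + m)) :
    data.comp R (data.braid m n) i j ↔ R i (finSumFinEquiv (finSumFinEquiv.symm j).swap) := by
  constructor
  · rintro ⟨k, h, h'⟩
    have h' : (finSumFinEquiv.symm k).swap = finSumFinEquiv.symm j := h'
    rw [← h']; simpa using h
  · intro h
    refine ⟨_, h, ?_⟩
    change (finSumFinEquiv.symm (finSumFinEquiv _)).swap = _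
    simp

theorem braid_comp {l m n : ℕ} (R : data.Hom (n + m) l) (i : Fin (m + n)) (j : Fin l) :
    data.comp (data.braid m n) R i j ↔ R (finSumFinEquiv (finSumFinEquiv.symm i).swap) j := by
  constructor
  · rintro ⟨k, h, h'⟩
    have h : (finSumFinEquiv.symm i).swap = finSumFinEquiv.symm k := h
    rw [h]; simpa using h'
  · intro h
    refine ⟨_, ?_, h⟩
    change (finSumFinEquiv.symm i).swap = finSumFinEquiv.symm (finSumFinEquiv _)
    simp

theorem tensor_braid_id_comp {m n p l : ℕ} (R : data.Hom (n + m + p) l) (i : Fin (m + n + p))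
    (j : Fin l) : data.comp (data.tensor (data.braid m n) (data.id p)) R i j ↔
      R (finSumFinEquiv (Sum.map (fun k => finSumFinEquiv (finSumFinEquiv.symm k).swap) id
        (finSumFinEquiv.symm i))) j := by
  have key : ∀ k, data.tensor (data.braid m n) (data.id p) i k ↔
      finSumFinEquiv (Sum.map (fun k => finSumFinEquiv (finSumFinEquiv.symm k).swap) id
        (finSumFinEquiv.symm i)) = k := by
    intro k
    rw [tensor_iff, ← Equiv.eq_symm_apply finSumFinEquiv]
    rcases finSumFinEquiv.symm i with x | x <;> rcases finSumFinEquiv.symm k with y | y <;>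
      simp [data, Equiv.eq_symm_apply]
  exact ⟨fun ⟨k, h, h'⟩ => by rwa [(key k).1 h], fun h => ⟨_, (key _).2 rfl, h⟩⟩

theorem cast_left {a b c : ℕ} (h : a + b + c = a + (b + c)) (x : Fin a) :
    Fin.cast h (Fin.castAdd c (Fin.castAdd b x)) = Fin.castAdd (b + c) x := rfl

theorem cast_mid {a b c : ℕ} (h : a + b + c = a + (b + c)) (x : Fin b) :
    Fin.cast h (Fin.castAdd c (Fin.natAdd a x)) = Fin.natAdd a (Fin.castAdd c x) := rfl

theorem cast_right {a b c : ℕ} (h : a + b + c = a + (b + c)) (x : Fin c) :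
    Fin.cast h (Fin.natAdd (a + b) x) = Fin.natAdd a (Fin.natAdd b x) :=
  Fin.ext (Nat.add_assoc a b x)

theorem cast_left' {a b c : ℕ} (h : a + (b + c) = a + b + c) (x : Fin a) :
    Fin.cast h (Fin.castAdd (b + c) x) = Fin.castAdd c (Fin.castAdd b x) := rfl

theorem cast_mid' {a b c : ℕ} (h : a + (b + c) = a + b + c) (x : Fin b) :
    Fin.cast h (Fin.natAdd a (Fin.castAdd c x)) = Fin.castAdd c (Fin.natAdd a x) := rfl

theorem cast_right' {a b c : ℕ} (h : a + (b + c) = a + b + c) (x : Fin c) :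
    Fin.cast h (Fin.natAdd a (Fin.natAdd b x)) = Fin.natAdd (a + b) x :=
  Fin.ext (Nat.add_assoc a b x).symm

/-- Induction over the three summands of `Fin (a + b + c)`. -/
theorem cases₃ {a b c : ℕ} {q : Fin (a + b + c) → Prop}
    (h₁ : ∀ x, q (Fin.castAdd c (Fin.castAdd b x))) (h₂ : ∀ x, q (Fin.castAdd c (Fin.natAdd a x)))
    (h₃ : ∀ x, q (Fin.natAdd (a + b) x)) (x) : q x :=
  Fin.addCases (Fin.addCases h₁ h₂) h₃ x

/-- Induction over the three summands of `Fin (a + (b + c))`. -/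
theorem cases₃' {a b c : ℕ} {q : Fin (a + (b + c)) → Prop}
    (h₁ : ∀ x, q (Fin.castAdd (b + c) x)) (h₂ : ∀ x, q (Fin.natAdd a (Fin.castAdd c x)))
    (h₃ : ∀ x, q (Fin.natAdd a (Fin.natAdd b x))) (x) : q x :=
  Fin.addCases h₁ (Fin.addCases h₂ h₃) x

end RelProp

open RelProp in
/-- The prop of relations between finite sets. -/
def relProp : PROP.{0} where
  toPropData := RelProp.data
  id_comp _ := Relation.eq_comp
  comp_id _ := Relation.comp_eq
  assoc _ _ _ := Relation.comp_assoc
  tensor_id m n := hom_ext fun i j =>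
    (liftRel_eq _ _).trans finSumFinEquiv.symm.injective.eq_iff
  tensor_comp f g f' g' := hom_ext fun i j => by
    refine (liftRel_comp _ _).symm.trans ?_
    exact finSumFinEquiv.exists_congr_left.trans Iff.rfl
  tensor_assoc f g h := hom_ext fun i j => by
    rw [comp_eqHom, eqHom_comp]
    induction i using cases₃ <;> induction j using cases₃' <;>
      simp only [cast_left, cast_mid, cast_right, cast_left', cast_mid', cast_right',
        tensor_ll, tensor_lr, tensor_rl, tensor_rr]
  id_zero_tensor {m n} f := hom_ext fun i j => by
    rw [comp_eqHom, eqHom_comp]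
    induction i using Fin.addCases with
    | left i => exact i.elim0
    | right i =>
      have hi : Fin.cast (Nat.zero_add m) (Fin.natAdd 0 i) = i := Fin.ext (Nat.zero_add _)
      have hj : Fin.cast (Nat.zero_add n).symm j = Fin.natAdd 0 j :=
        Fin.ext (Nat.zero_add _).symm
      rw [hi, hj, tensor_rr]
  tensor_id_zero f := hom_ext fun i j => tensor_ll f (data.id 0) i j
  braid_natural f g := hom_ext fun i j => by
    rw [comp_braid, braid_comp, tensor_iff, tensor_iff, Equiv.symm_apply_apply,
      Equiv.symm_apply_apply]
    exact liftRel_swap _ _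
  braid_symm m n := hom_ext fun i j => by
    rw [comp_braid]
    change (finSumFinEquiv.symm i).swap = finSumFinEquiv.symm (finSumFinEquiv _) ↔ i = j
    simp [Sum.swap_leftInverse.injective.eq_iff]
  hexagon m n p := hom_ext fun i j => by
    rw [eqHom_comp, comp_eqHom, tensor_braid_id_comp, eqHom_comp]
    induction i using cases₃ <;> induction j using cases₃' <;>
      simp [cast_left, cast_mid, cast_right, cast_left', cast_mid', cast_right',
        data]
    · exact fun h => absurd (congrArg Fin.val h) (by simp; omega)
    · exact fun h => absurd (congrArg Fin.val h) (by simp; omega)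

end SymMonTheory

/-!
A model of a theory on an object `X` of a symmetric monoidal category `C` interprets every term as a
morphism between tensor powers of `X`. These morphisms form a prop, the endomorphism prop of `X`, so
the presented prop maps to it; composing with `n ↦ X ^ n` turns models into algebras. Conversely,
for an algebra `F` the isomorphisms `F(1) ^ n ≅ F(n)` assembled from the structure morphisms of `F`
identify `F` with the algebra built from its underlying model.

Reading every generator as the total relation gives a morphism of props from terms to relations. It
is bijective on hom-sets because of a normal form. If `X` is a bicommutative bimonoid, tensor powers
of `X` are products in the category of cocommutative comonoids, and morphisms of comonoids into `X`
form a commutative monoid under convolution. A relation `R` thus defines a morphism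
`X ^ m ⟶ X ^ n` whose `j`-th component is the product of the projections `p i` over all `i` related
to `j`. The special law makes convolution idempotent, which is what makes this assignment compatible
with composition; hence every term evaluates to the morphism defined by the relation it denotes, and
terms denoting the same relation are equal in the presented prop. The relation is recovered from its
morphism by plugging units and counits, provided that `ε ≫ η` is not the identity. Since every
morphism of the presented prop is represented by a term, the morphism attached to an arbitrary
relation shows that the relation is denoted by a term.
-/

namespace SymMonTheory

/-! ### The endomorphism prop of an object -/

section EndomorphismProp

variable {C : Type u} [Category.{v} C] [MonoidalCategory C] (X : C)

theorem eqToHom_pow_succ {m n : ℕ} (h : m = n) :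
    eqToHom (congrArg (pow X) (congrArg Nat.succ h)) = eqToHom (congrArg (pow X) h) ▷ X := by
  subst h
  exact (id_whiskerRight _ _).symm

theorem powAdd_succ_hom (m n : ℕ) : (powAdd X m (n + 1)).hom =
    (powAdd X m n).hom ▷ X ≫ (α_ (pow X m) (pow X n) X).hom := rfl

theorem powAdd_assoc (a b c : ℕ) :
    (powAdd X (a + b) c).hom ≫ (powAdd X a b).hom ▷ pow X c ≫ (α_ _ _ _).hom =
      eqToHom (congrArg (pow X) (Nat.add_assoc a b c)) ≫ (powAdd X a (b + c)).hom ≫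
        pow X a ◁ (powAdd X b c).hom := by
  induction c with
  | zero =>
    change (ρ_ _).inv ≫ (powAdd X a b).hom ▷ 𝟙_ C ≫ (α_ _ _ _).hom =
      𝟙 _ ≫ (powAdd X a b).hom ≫ pow X a ◁ (ρ_ _).inv
    simp
  | succ c ih =>
    have h : eqToHom (congrArg (pow X) (Nat.add_assoc a b (c + 1))) =
        eqToHom (congrArg (pow X) (Nat.add_assoc a b c)) ▷ X :=
      eqToHom_pow_succ X (Nat.add_assoc a b c)
    have ih' := congrArg (· ▷ X) ih
    simp only [comp_whiskerRight] at ih'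
    rw [h]
    change ((powAdd X (a + b) c).hom ▷ X ≫ (α_ _ _ _).hom) ≫
      (powAdd X a b).hom ▷ (pow X c ⊗ X) ≫ (α_ _ _ _).hom = _ ≫
      ((powAdd X a (b + c)).hom ▷ X ≫ (α_ _ _ _).hom) ≫
        pow X a ◁ ((powAdd X b c).hom ▷ X ≫ (α_ _ _ _).hom)
    simp only [Category.assoc, MonoidalCategory.whiskerLeft_comp]
    rw [← associator_naturality_middle_assoc, ← reassoc_of% ih', pentagon,
      ← associator_naturality_left_assoc]

theorem powAdd_zero_left (n : ℕ) :
    (powAdd X 0 n).hom ≫ (λ_ (pow X n)).hom = eqToHom (congrArg (pow X) (Nat.zero_add n)) := by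
  induction n with
  | zero => exact (congrArg (_ ≫ ·) (unitors_equal (C := C))).trans (Iso.inv_hom_id _)
  | succ n ih =>
    have h : eqToHom (congrArg (pow X) (Nat.zero_add (n + 1))) =
        eqToHom (congrArg (pow X) (Nat.zero_add n)) ▷ X := eqToHom_pow_succ X (Nat.zero_add n)
    rw [h, ← ih, powAdd_succ_hom]
    simp [pow]

theorem powAdd_inv_assoc (a b c : ℕ) :
    (powAdd X a b).inv ▷ pow X c ≫ (powAdd X (a + b) c).inv ≫
      eqToHom (congrArg (pow X) (Nat.add_assoc a b c)) =
    (α_ _ _ _).hom ≫ pow X a ◁ (powAdd X b c).inv ≫ (powAdd X a (b + c)).inv := by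
  rw [← cancel_mono ((powAdd X a (b + c)).hom ≫ pow X a ◁ (powAdd X b c).hom)]
  simp only [Category.assoc, ← powAdd_assoc]
  simp

variable {X}

/-- The tensor product of two morphisms between tensor powers of `X`. -/
def powTensor {m n p q : ℕ} (f : pow X m ⟶ pow X n) (g : pow X p ⟶ pow X q) :
    pow X (m + p) ⟶ pow X (n + q) :=
  (powAdd X m p).hom ≫ (f ⊗ₘ g) ≫ (powAdd X n q).inv

theorem powTensor_powAdd_hom {m n p q : ℕ} (f : pow X m ⟶ pow X n) (g : pow X p ⟶ pow X q) :
    powTensor f g ≫ (powAdd X n q).hom = (powAdd X m p).hom ≫ (f ⊗ₘ g) := by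
  simp [powTensor]

theorem powTensor_id (m n : ℕ) : powTensor (𝟙 (pow X m)) (𝟙 (pow X n)) = 𝟙 (pow X (m + n)) := by
  simp [powTensor]

theorem powTensor_comp {l m n p q r : ℕ} (f : pow X l ⟶ pow X m) (g : pow X m ⟶ pow X n)
    (f' : pow X p ⟶ pow X q) (g' : pow X q ⟶ pow X r) :
    powTensor (f ≫ g) (f' ≫ g') = powTensor f f' ≫ powTensor g g' := by
  simp [powTensor]

theorem powTensor_assoc {a b c a' b' c' : ℕ} (f : pow X a ⟶ pow X a')
    (g : pow X b ⟶ pow X b') (h : pow X c ⟶ pow X c') :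
    powTensor (powTensor f g) h ≫ eqToHom (congrArg (pow X) (Nat.add_assoc a' b' c')) =
      eqToHom (congrArg (pow X) (Nat.add_assoc a b c)) ≫ powTensor f (powTensor g h) := by
  rw [← cancel_mono ((powAdd X a' (b' + c')).hom ≫ pow X a' ◁ (powAdd X b' c').hom)]
  simp only [Category.assoc]
  rw [← powAdd_assoc, reassoc_of% powTensor_powAdd_hom, reassoc_of% powTensor_powAdd_hom,
    tensorHom_comp_whiskerLeft, tensorHom_comp_whiskerRight_assoc, powTensor_powAdd_hom,
    powTensor_powAdd_hom, ← whiskerLeft_comp_tensorHom, ← whiskerRight_comp_tensorHom_assoc,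
    associator_naturality]
  exact (reassoc_of% (powAdd_assoc X a b c)) _

theorem id_zero_powTensor {m n : ℕ} (f : pow X m ⟶ pow X n) :
    powTensor (𝟙 (pow X 0)) f ≫ eqToHom (congrArg (pow X) (Nat.zero_add n)) =
      eqToHom (congrArg (pow X) (Nat.zero_add m)) ≫ f := by
  have h : powTensor (𝟙 (pow X 0)) f ≫ (powAdd X 0 n).hom = (powAdd X 0 m).hom ≫ 𝟙_ C ◁ f := by
    rw [powTensor_powAdd_hom, id_tensorHom]
    rfl
  rw [← powAdd_zero_left, ← powAdd_zero_left]
  calc powTensor (𝟙 (pow X 0)) f ≫ (powAdd X 0 n).hom ≫ (λ_ (pow X n)).hom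
    _ = ((powAdd X 0 m).hom ≫ 𝟙_ C ◁ f) ≫ (λ_ (pow X n)).hom :=
      (Category.assoc _ _ _).symm.trans (congrArg (· ≫ _) h)
    _ = (powAdd X 0 m).hom ≫ (λ_ (pow X m)).hom ≫ f :=
      (Category.assoc _ _ _).trans (congrArg (_ ≫ ·) (leftUnitor_naturality f))
    _ = ((powAdd X 0 m).hom ≫ (λ_ (pow X m)).hom) ≫ f := (Category.assoc _ _ _).symm

theorem powTensor_id_zero {m n : ℕ} (f : pow X m ⟶ pow X n) : powTensor f (𝟙 (pow X 0)) = f := by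
  change (ρ_ _).inv ≫ (f ⊗ₘ 𝟙 (𝟙_ C)) ≫ (ρ_ _).hom = f
  rw [tensorHom_id, rightUnitor_naturality, Iso.inv_hom_id_assoc]

variable [SymmetricCategory C] (X)

/-- The braiding of two tensor powers of `X`. -/
def powBraid (m n : ℕ) : pow X (m + n) ⟶ pow X (n + m) :=
  (powAdd X m n).hom ≫ (β_ (pow X m) (pow X n)).hom ≫ (powAdd X n m).inv

theorem powBraid_powAdd_hom (m n : ℕ) : powBraid X m n ≫ (powAdd X n m).hom =
    (powAdd X m n).hom ≫ (β_ (pow X m) (pow X n)).hom := by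
  simp [powBraid]

variable {X} in
theorem powBraid_natural {m n p q : ℕ} (f : pow X m ⟶ pow X n) (g : pow X p ⟶ pow X q) :
    powTensor f g ≫ powBraid X n q = powBraid X m p ≫ powTensor g f := by
  simp [powTensor, powBraid]

theorem powBraid_symm (m n : ℕ) : powBraid X m n ≫ powBraid X n m = 𝟙 (pow X (m + n)) := by
  simp [powBraid]

theorem powBraid_hexagon (m n p : ℕ) :
    eqToHom (congrArg (pow X) (Nat.add_assoc m n p)) ≫ powBraid X m (n + p) ≫
        eqToHom (congrArg (pow X) (Nat.add_assoc n p m)) =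
      powTensor (powBraid X m n) (𝟙 (pow X p)) ≫
        eqToHom (congrArg (pow X) (Nat.add_assoc n m p)) ≫
          powTensor (𝟙 (pow X n)) (powBraid X m p) := by
  rw [← cancel_mono ((powAdd X n (p + m)).hom ≫ pow X n ◁ (powAdd X p m).hom)]
  simp only [Category.assoc]
  rw [← powAdd_assoc, reassoc_of% powBraid_powAdd_hom, reassoc_of% powTensor_powAdd_hom,
    id_tensorHom, ← MonoidalCategory.whiskerLeft_comp, powBraid_powAdd_hom,
    MonoidalCategory.whiskerLeft_comp, ← reassoc_of% (powAdd_assoc X n m p),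
    reassoc_of% powTensor_powAdd_hom, tensorHom_id, ← comp_whiskerRight_assoc,
    powBraid_powAdd_hom, comp_whiskerRight_assoc, ← BraidedCategory.hexagon_forward,
    reassoc_of% (powAdd_assoc X m n p), BraidedCategory.braiding_naturality_right_assoc]

/-- The operations of the endomorphism prop of `X`. -/
def endData : PropData.{v} where
  Hom m n := pow X m ⟶ pow X n
  id n := 𝟙 (pow X n)
  comp f g := f ≫ g
  tensor := powTensor
  braid := powBraid X

theorem endData_eqHom {m n : ℕ} (h : m = n) :
    (endData X).eqHom h = eqToHom (congrArg (pow X) h) := by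
  subst h; rfl

/-- The endomorphism prop of `X`, whose morphisms `m ⟶ n` are the morphisms `X^{⊗ m} ⟶ X^{⊗ n}`:
evaluating a term at `X` amounts to interpreting it in this prop. -/
def endProp : PROP.{v} where
  toPropData := endData X
  id_comp := Category.id_comp (obj := C)
  comp_id := Category.comp_id (obj := C)
  assoc := Category.assoc (obj := C)
  tensor_id := powTensor_id
  tensor_comp := powTensor_comp
  tensor_assoc f g h := by
    rw [endData_eqHom, endData_eqHom]; exact powTensor_assoc f g h
  id_zero_tensor f := by
    rw [endData_eqHom, endData_eqHom]; exact id_zero_powTensor f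
  tensor_id_zero := powTensor_id_zero
  braid_natural := powBraid_natural
  braid_symm := powBraid_symm X
  hexagon m n p := by
    rw [endData_eqHom, endData_eqHom, endData_eqHom]; exact powBraid_hexagon X m n p

end EndomorphismProp

section Interpretation

universe w'

/-- The interpretation of a term in a prop, given the interpretation of the generators. -/
def Term.interp {Gen : ℕ → ℕ → Type w} (Q : PROP.{w'})
    (op : ∀ {m n : ℕ}, Gen m n → Q.Hom m n) : ∀ {m n : ℕ}, Term Gen m n → Q.Hom m n
  | _, _, .gen σ => op σ
  | _, _, .id n => Q.id n
  | _, _, .braid m n => Q.braid m n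
  | _, _, .comp s t => Q.comp (s.interp Q op) (t.interp Q op)
  | _, _, .tensor s t => Q.tensor (s.interp Q op) (t.interp Q op)

theorem Term.interp_endProp {C : Type u} [Category.{v} C] [MonoidalCategory C]
    [SymmetricCategory C] {Gen : ℕ → ℕ → Type w} (X : C)
    (op : ∀ {m n : ℕ}, Gen m n → (pow X m ⟶ pow X n)) {m n : ℕ} (t : Term Gen m n) :
    t.interp (endProp X) op = t.eval X op := by
  induction t with
  | gen | id | braid => rfl
  | comp s t ihs iht => exact congrArg₂ (· ≫ ·) ihs iht
  | tensor s t ihs iht => exact congrArg₂ (fun f g => _ ≫ (f ⊗ₘ g) ≫ _) ihs iht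

variable (T : Theory.{w}) (Q : PROP.{w'}) (op : ∀ {m n : ℕ}, T.Gen m n → Q.Hom m n)

theorem Term.interp_eqHom {m n : ℕ} (h : m = n) :
    Term.interp Q op ((termData T.Gen).eqHom h) = Q.eqHom h := by
  subst h; rfl

variable (sat : ∀ {m n : ℕ} {s t : Term T.Gen m n}, T.Eqn s t → s.interp Q op = t.interp Q op)

include sat in
theorem Theory.interp_congr {m n : ℕ} {s t : (termData T.Gen).Hom m n}
    (h : (termData T.Gen).Cong T.Eqn s t) : Term.interp Q op s = Term.interp Q op t := by
  induction h with
  | of h => exact sat h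
  | refl => rfl
  | symm _ ih => exact ih.symm
  | trans _ _ ih ih' => exact ih.trans ih'
  | comp_congr _ _ ih ih' => exact congrArg₂ Q.comp ih ih'
  | tensor_congr _ _ ih ih' => exact congrArg₂ Q.tensor ih ih'
  | id_comp => exact Q.id_comp _
  | comp_id => exact Q.comp_id _
  | assoc => exact Q.assoc _ _ _
  | tensor_id => exact Q.tensor_id _ _
  | tensor_comp => exact Q.tensor_comp _ _ _ _
  | tensor_assoc =>
    refine (congrArg (Q.comp _) (Term.interp_eqHom T Q op _)).trans
      ((Q.tensor_assoc _ _ _).trans (congrArg (Q.comp · _) (Term.interp_eqHom T Q op _).symm))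
  | id_zero_tensor =>
    refine (congrArg (Q.comp _) (Term.interp_eqHom T Q op _)).trans
      ((Q.id_zero_tensor _).trans (congrArg (Q.comp · _) (Term.interp_eqHom T Q op _).symm))
  | tensor_id_zero => exact Q.tensor_id_zero _
  | braid_natural => exact Q.braid_natural _ _
  | braid_symm => exact Q.braid_symm _ _
  | hexagon m n p =>
    change Q.comp (Term.interp Q op ((termData T.Gen).eqHom _)) (Q.comp _
      (Term.interp Q op ((termData T.Gen).eqHom _))) = Q.comp _ (Q.comp
      (Term.interp Q op ((termData T.Gen).eqHom _)) _)
    rw [Term.interp_eqHom, Term.interp_eqHom, Term.interp_eqHom]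
    exact Q.hexagon m n p

variable {T}

/-- The class of a term in the prop presented by a theory. -/
def Theory.ofTerm {m n : ℕ} (t : Term T.Gen m n) : (⟨m⟩ : T.prop.Ob) ⟶ ⟨n⟩ :=
  Quot.mk _ t

theorem Theory.exists_ofTerm_eq {m n : ℕ} (f : (⟨m⟩ : T.prop.Ob) ⟶ ⟨n⟩) :
    ∃ t : Term T.Gen m n, T.ofTerm t = f :=
  Quot.exists_rep f

/-- The operation on morphisms of the functor out of the presented prop determined by an
interpretation of the generators satisfying the equations. The universe of `Q` need not be that
of `T`, so that `Q` may be an endomorphism prop. -/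
def Theory.lift {m n : ℕ} (f : T.prop.Hom m n) : Q.Hom m n :=
  Quot.lift (fun t => Term.interp Q op t) (fun _ _ h => T.interp_congr Q op sat h) f

end Interpretation

/-- The morphism of props determined by an interpretation of the generators of a theory satisfying
its equations. -/
def Theory.desc (T : Theory.{w}) (Q : PROP.{w}) (op : ∀ {m n : ℕ}, T.Gen m n → Q.Hom m n)
    (sat : ∀ {m n : ℕ} {s t : Term T.Gen m n}, T.Eqn s t → s.interp Q op = t.interp Q op) :
    T.prop ⟶ Q where
  map := Theory.lift Q op sat
  map_id _ := rfl
  map_comp := by rintro _ _ _ ⟨f⟩ ⟨g⟩; rfl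
  map_tensor := by rintro _ _ _ _ ⟨f⟩ ⟨g⟩; rfl
  map_braid _ _ := rfl

namespace PROP

variable {P Q : PROP.{w}} (F : P ⟶ Q)
  (h : ∀ m n : ℕ, Function.Bijective (fun f : P.Hom m n => Morphism.map F f))

/-- A morphism of props which is bijective on morphisms is an isomorphism. -/
noncomputable def isoOfBijective : P ≅ Q :=
  let e {m n : ℕ} : P.Hom m n ≃ Q.Hom m n := Equiv.ofBijective _ (h m n)
  have map_symm {m n : ℕ} (f : Q.Hom m n) : Morphism.map F (e.symm f) = f := e.apply_symm_apply f
  have inj {m n : ℕ} {f g : P.Hom m n} (hfg : Morphism.map F f = Morphism.map F g) : f = g :=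
    (h m n).injective hfg
  { hom := F
    inv :=
      { map f := e.symm f
        map_id n := inj ((map_symm _).trans (Morphism.map_id F n).symm)
        map_comp f g := inj (by rw [Morphism.map_comp, map_symm, map_symm, map_symm])
        map_tensor f g := inj (by rw [Morphism.map_tensor, map_symm, map_symm, map_symm])
        map_braid m n := inj ((map_symm _).trans (Morphism.map_braid F m n).symm) }
    hom_inv_id := Morphism.ext (by funext m n f; exact inj (map_symm _))
    inv_hom_id := Morphism.ext (by funext m n f; exact map_symm f) }

end PROP

/-! ### Algebras of a presented prop and models -/

section PowMap

variable {C : Type u} [Category.{v} C] [MonoidalCategory C] {X Y : C} (f : X ⟶ Y)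

theorem powMap_one : powMap f 1 ≫ (λ_ Y).hom = (λ_ X).hom ≫ f := by
  change (𝟙 (𝟙_ C) ⊗ₘ f) ≫ _ = _
  rw [id_tensorHom, leftUnitor_naturality]

theorem powMap_powAdd_hom (m n : ℕ) :
    powMap f (m + n) ≫ (powAdd Y m n).hom = (powAdd X m n).hom ≫ (powMap f m ⊗ₘ powMap f n) := by
  induction n with
  | zero =>
    change powMap f m ≫ (ρ_ _).inv = (ρ_ _).inv ≫ (powMap f m ⊗ₘ 𝟙 (𝟙_ C))
    rw [tensorHom_id, rightUnitor_inv_naturality]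
  | succ n ih =>
    change (powMap f (m + n) ⊗ₘ f) ≫ (powAdd Y m n).hom ▷ Y ≫ (α_ _ _ _).hom =
      ((powAdd X m n).hom ▷ X ≫ (α_ _ _ _).hom) ≫ (powMap f m ⊗ₘ (powMap f n ⊗ₘ f))
    rw [tensorHom_comp_whiskerRight_assoc, ih, Category.assoc, ← associator_naturality,
      ← whiskerRight_comp_tensorHom_assoc]

variable {f} in
theorem powTensor_powMap {m n p q : ℕ} {r : pow X m ⟶ pow X n} {r' : pow Y m ⟶ pow Y n}
    {s : pow X p ⟶ pow X q} {s' : pow Y p ⟶ pow Y q}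
    (hr : r ≫ powMap f n = powMap f m ≫ r') (hs : s ≫ powMap f q = powMap f p ≫ s') :
    powTensor r s ≫ powMap f (n + q) = powMap f (m + p) ≫ powTensor r' s' := by
  rw [← cancel_mono (powAdd Y n q).hom, Category.assoc, Category.assoc, powMap_powAdd_hom,
    reassoc_of% powTensor_powAdd_hom, powTensor_powAdd_hom, reassoc_of% powMap_powAdd_hom,
    tensorHom_comp_tensorHom, tensorHom_comp_tensorHom, hr, hs]

variable [SymmetricCategory C]

theorem powBraid_powMap (m n : ℕ) :
    powBraid X m n ≫ powMap f (n + m) = powMap f (m + n) ≫ powBraid Y m n := by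
  rw [← cancel_mono (powAdd Y n m).hom, Category.assoc, Category.assoc, powMap_powAdd_hom,
    reassoc_of% powBraid_powAdd_hom, powBraid_powAdd_hom, reassoc_of% powMap_powAdd_hom,
    BraidedCategory.braiding_naturality]

variable {f} in
theorem Term.eval_powMap {Gen : ℕ → ℕ → Type w}
    {op : ∀ {m n : ℕ}, Gen m n → (pow X m ⟶ pow X n)}
    {op' : ∀ {m n : ℕ}, Gen m n → (pow Y m ⟶ pow Y n)}
    (comm : ∀ {m n : ℕ} (σ : Gen m n), op σ ≫ powMap f n = powMap f m ≫ op' σ)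
    {m n : ℕ} (t : Term Gen m n) :
    t.eval X op ≫ powMap f n = powMap f m ≫ t.eval Y op' := by
  induction t with
  | gen σ => exact comm σ
  | id n => exact (Category.id_comp _).trans (Category.comp_id _).symm
  | braid m n => exact powBraid_powMap f m n
  | comp s t ihs iht => rw [eval, eval, Category.assoc, iht, reassoc_of% ihs]
  | tensor s t ihs iht => exact powTensor_powMap ihs iht

end PowMap

namespace PROP

open Functor.LaxMonoidal

variable {C : Type u} [Category.{v} C] [MonoidalCategory C] {P : PROP.{w}}

/-- The canonical isomorphism from the tensor power of the value of a monoidal functor at `1` to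
its value at `n`. -/
def powIso (F : P.Ob ⥤ C) [F.Monoidal] : ∀ n : ℕ, pow (F.obj ⟨1⟩) n ≅ F.obj ⟨n⟩
  | 0 => Functor.Monoidal.εIso F
  | n + 1 => whiskerRightIso (powIso F n) (F.obj ⟨1⟩) ≪≫ Functor.Monoidal.μIso F ⟨n⟩ ⟨1⟩

variable (F G : P.Ob ⥤ C) [F.Monoidal] [G.Monoidal]

theorem powIso_succ_hom (n : ℕ) :
    (powIso F (n + 1)).hom = (powIso F n).hom ▷ F.obj ⟨1⟩ ≫ μ F ⟨n⟩ ⟨1⟩ := rfl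

theorem powIso_one_hom : (powIso F 1).hom = (λ_ (F.obj ⟨1⟩)).hom := by
  refine Eq.trans ?_ (left_unitality F ⟨1⟩).symm
  exact (congrArg (_ ≫ ·) ((congrArg (_ ≫ ·) (F.map_id _)).trans (Category.comp_id _))).symm

theorem powIso_add_hom (m n : ℕ) :
    (powIso F (m + n)).hom = (powAdd (F.obj ⟨1⟩) m n).hom ≫
      ((powIso F m).hom ⊗ₘ (powIso F n).hom) ≫ μ F ⟨m⟩ ⟨n⟩ := by
  induction n with
  | zero =>
    have unitality : F.obj ⟨m⟩ ◁ ε F ≫ μ F ⟨m⟩ (𝟙_ P.Ob) = (ρ_ (F.obj ⟨m⟩)).hom :=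
      ((right_unitality F ⟨m⟩).trans (congrArg (_ ≫ ·)
        ((congrArg (_ ≫ ·) (F.map_id _)).trans (Category.comp_id _)))).symm
    change (powIso F m).hom = (ρ_ _).inv ≫ ((powIso F m).hom ⊗ₘ ε F) ≫ μ F ⟨m⟩ (𝟙_ P.Ob)
    rw [tensorHom_def_assoc, unitality]
    exact ((congrArg (_ ≫ ·) (rightUnitor_naturality _)).trans (Iso.inv_hom_id_assoc _ _)).symm
  | succ n ih =>
    have associativity : μ F ⟨m⟩ ⟨n⟩ ▷ F.obj ⟨1⟩ ≫ μ F ⟨m + n⟩ ⟨1⟩ =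
        (α_ _ _ _).hom ≫ F.obj ⟨m⟩ ◁ μ F ⟨n⟩ ⟨1⟩ ≫ μ F ⟨m⟩ ⟨n + 1⟩ :=
      (congrArg (_ ≫ ·) ((congrArg (_ ≫ ·) (F.map_id _)).trans (Category.comp_id _))).symm.trans
        (associativity F ⟨m⟩ ⟨n⟩ ⟨1⟩)
    calc (powIso F (m + n)).hom ▷ F.obj ⟨1⟩ ≫ μ F ⟨m + n⟩ ⟨1⟩
      _ = (powAdd (F.obj ⟨1⟩) m n).hom ▷ F.obj ⟨1⟩ ≫
          ((powIso F m).hom ⊗ₘ (powIso F n).hom) ▷ F.obj ⟨1⟩ ≫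
            μ F ⟨m⟩ ⟨n⟩ ▷ F.obj ⟨1⟩ ≫ μ F ⟨m + n⟩ ⟨1⟩ := by
        rw [ih, comp_whiskerRight_assoc]
        exact congrArg (_ ≫ ·) (comp_whiskerRight_assoc _ _ _ _)
      _ = (powAdd (F.obj ⟨1⟩) m n).hom ▷ F.obj ⟨1⟩ ≫ (α_ _ _ _).hom ≫
          ((powIso F m).hom ⊗ₘ (powIso F n).hom ▷ F.obj ⟨1⟩) ≫
            F.obj ⟨m⟩ ◁ μ F ⟨n⟩ ⟨1⟩ ≫ μ F ⟨m⟩ ⟨n + 1⟩ := by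
        rw [associativity, ← tensorHom_id ((powIso F m).hom ⊗ₘ (powIso F n).hom),
          associator_naturality_assoc, tensorHom_id]
      _ = ((powAdd (F.obj ⟨1⟩) m n).hom ▷ F.obj ⟨1⟩ ≫ (α_ _ _ _).hom) ≫
          ((powIso F m).hom ⊗ₘ (powIso F n).hom ▷ F.obj ⟨1⟩ ≫ μ F ⟨n⟩ ⟨1⟩) ≫
            μ F ⟨m⟩ ⟨n + 1⟩ := by
        rw [tensorHom_comp_whiskerLeft_assoc, Category.assoc]

variable {F G} in
theorem powIso_hom_naturality (τ : F ⟶ G) [NatTrans.IsMonoidal τ] (n : ℕ) :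
    (powIso F n).hom ≫ τ.app ⟨n⟩ = powMap (τ.app ⟨1⟩) n ≫ (powIso G n).hom := by
  induction n with
  | zero => exact (NatTrans.IsMonoidal.unit (τ := τ)).trans (Category.id_comp _).symm
  | succ n ih =>
    calc ((powIso F n).hom ▷ F.obj ⟨1⟩ ≫ μ F ⟨n⟩ ⟨1⟩) ≫ τ.app (⟨n⟩ ⊗ ⟨1⟩)
      _ = ((powIso F n).hom ≫ τ.app ⟨n⟩ ⊗ₘ τ.app ⟨1⟩) ≫ μ G ⟨n⟩ ⟨1⟩ := by
        rw [Category.assoc, NatTrans.IsMonoidal.tensor, whiskerRight_comp_tensorHom_assoc]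
      _ = (powMap (τ.app ⟨1⟩) n ⊗ₘ τ.app ⟨1⟩) ≫ (powIso G (n + 1)).hom := by
        rw [ih, powIso_succ_hom, tensorHom_comp_whiskerRight_assoc]

end PROP

section Algebras

open Functor.LaxMonoidal PROP

variable {C : Type u} [Category.{v} C] [MonoidalCategory C] [SymmetricCategory C]
  {T : Theory.{w}} (A : Algebra T.prop C)

namespace Algebra

/-- The interpretation of the generators of a theory in the tensor powers of the underlying object
of an algebra of the presented prop. -/
def op {m n : ℕ} (σ : T.Gen m n) :
    pow (A.functor.obj ⟨1⟩) m ⟶ pow (A.functor.obj ⟨1⟩) n :=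
  (powIso A.functor m).hom ≫ A.functor.map (T.ofTerm (.gen σ)) ≫ (powIso A.functor n).inv

theorem powBraid_comp_powIso_hom (m n : ℕ) :
    powBraid (A.functor.obj ⟨1⟩) m n ≫ (powIso A.functor (n + m)).hom =
      (powIso A.functor (m + n)).hom ≫ A.functor.map (β_ (⟨m⟩ : T.prop.Ob) ⟨n⟩).hom := by
  rw [powIso_add_hom, reassoc_of% powBraid_powAdd_hom, powIso_add_hom, Category.assoc,
    Category.assoc, Functor.LaxBraided.braided, BraidedCategory.braiding_naturality_assoc]

theorem powTensor_comp_powIso_hom {m n p q : ℕ}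
    {f : pow (A.functor.obj ⟨1⟩) m ⟶ pow (A.functor.obj ⟨1⟩) n}
    {g : pow (A.functor.obj ⟨1⟩) p ⟶ pow (A.functor.obj ⟨1⟩) q}
    {s : (⟨m⟩ : T.prop.Ob) ⟶ ⟨n⟩} {t : (⟨p⟩ : T.prop.Ob) ⟶ ⟨q⟩}
    (hf : f ≫ (powIso A.functor n).hom = (powIso A.functor m).hom ≫ A.functor.map s)
    (hg : g ≫ (powIso A.functor q).hom = (powIso A.functor p).hom ≫ A.functor.map t) :
    powTensor f g ≫ (powIso A.functor (n + q)).hom =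
      (powIso A.functor (m + p)).hom ≫ A.functor.map (s ⊗ₘ t) := by
  rw [powIso_add_hom, reassoc_of% powTensor_powAdd_hom, tensorHom_comp_tensorHom_assoc, hf, hg,
    powIso_add_hom, Category.assoc, Category.assoc, ← μ_natural, tensorHom_comp_tensorHom_assoc]

theorem eval_comp_powIso_hom {m n : ℕ} (t : Term T.Gen m n) :
    t.eval _ A.op ≫ (powIso A.functor n).hom =
      (powIso A.functor m).hom ≫ A.functor.map (T.ofTerm t) := by
  induction t with
  | gen σ => simp [Term.eval, op]
  | id n =>
    exact (Category.id_comp _).trans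
      ((congrArg (_ ≫ ·) (A.functor.map_id _)).trans (Category.comp_id _)).symm
  | braid m n => exact A.powBraid_comp_powIso_hom m n
  | comp s t ihs iht =>
    rw [Term.eval, Category.assoc, iht, reassoc_of% ihs]
    exact congrArg (_ ≫ ·) (A.functor.map_comp _ _).symm
  | tensor s t ihs iht => exact A.powTensor_comp_powIso_hom ihs iht

/-- The model on the underlying object of an algebra of the presented prop. -/
def model : Model C T where
  X := A.functor.obj ⟨1⟩
  op := A.op
  sat h := by
    rw [← cancel_mono (powIso A.functor _).hom, eval_comp_powIso_hom, eval_comp_powIso_hom]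
    exact congrArg (fun f => _ ≫ A.functor.map f) (Quot.sound (.of h))

variable {A} {B : Algebra T.prop C}

theorem op_powMap_app (τ : A ⟶ B) {m n : ℕ} (σ : T.Gen m n) :
    A.op σ ≫ powMap ((Hom.trans τ).app ⟨1⟩) n = powMap ((Hom.trans τ).app ⟨1⟩) m ≫ B.op σ := by
  rw [← cancel_mono (powIso B.functor n).hom, Category.assoc, ← powIso_hom_naturality]
  simp [op, reassoc_of% powIso_hom_naturality]

end Algebra

variable (C T) in
/-- The functor from the algebras of the prop presented by a theory to the models of the theory. -/
def toModel : Algebra T.prop C ⥤ Model C T where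
  obj := Algebra.model
  map τ := ⟨(Algebra.Hom.trans τ).app ⟨1⟩, Algebra.op_powMap_app τ⟩

instance : (toModel C T).Faithful where
  map_injective {A B τ τ'} h := by
    have app_one : (Algebra.Hom.trans τ).app ⟨1⟩ = (Algebra.Hom.trans τ').app ⟨1⟩ :=
      congrArg Model.Hom.hom h
    refine Algebra.Hom.ext (NatTrans.ext (funext fun ⟨n⟩ => ?_))
    rw [← cancel_epi (powIso A.functor n).hom, powIso_hom_naturality, app_one,
      powIso_hom_naturality]

end Algebras

section FullyFaithful

open Functor.LaxMonoidal PROP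

variable {C : Type u} [Category.{v} C] [MonoidalCategory C] [SymmetricCategory C]
  {T : Theory.{w}} {A B : Algebra T.prop C}

namespace Algebra

variable (h : A.functor.obj ⟨1⟩ ⟶ B.functor.obj ⟨1⟩)
  (comm : ∀ {m n : ℕ} (σ : T.Gen m n), A.op σ ≫ powMap h n = powMap h m ≫ B.op σ)

/-- The extension of a morphism of models to a natural transformation of algebras: its components
are forced by the identifications of the values of an algebra with tensor powers. -/
def transMk : A.functor ⟶ B.functor where
  app n := (powIso A.functor n.val).inv ≫ powMap h n.val ≫ (powIso B.functor n.val).hom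
  naturality := by
    intro ⟨m⟩ ⟨n⟩ f
    obtain ⟨t, rfl⟩ := Theory.exists_ofTerm_eq f
    rw [← cancel_epi (powIso A.functor m).hom, Category.assoc, Category.assoc,
      Iso.hom_inv_id_assoc, ← eval_comp_powIso_hom, ← reassoc_of% (Term.eval_powMap comm t),
      ← reassoc_of% eval_comp_powIso_hom, Iso.hom_inv_id_assoc]

theorem powIso_hom_transMk (n : ℕ) : (powIso A.functor n).hom ≫ (transMk h comm).app ⟨n⟩ =
    powMap h n ≫ (powIso B.functor n).hom :=
  Iso.hom_inv_id_assoc _ _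

theorem transMk_app_one : (transMk h comm).app ⟨1⟩ = h := by
  rw [← cancel_epi (powIso A.functor 1).hom, powIso_hom_transMk, powIso_one_hom, powIso_one_hom]
  exact powMap_one _

instance : NatTrans.IsMonoidal (transMk h comm) where
  unit := (powIso_hom_transMk h comm 0).trans (Category.id_comp _)
  tensor := by
    intro ⟨m⟩ ⟨n⟩
    rw [← cancel_epi ((powAdd _ m n).hom ≫ ((powIso A.functor m).hom ⊗ₘ (powIso A.functor n).hom)),
      Category.assoc, Category.assoc, tensorHom_comp_tensorHom_assoc, powIso_hom_transMk,
      powIso_hom_transMk]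
    calc (powAdd _ m n).hom ≫ ((powIso A.functor m).hom ⊗ₘ (powIso A.functor n).hom) ≫
          μ A.functor ⟨m⟩ ⟨n⟩ ≫ (transMk h comm).app ⟨m + n⟩
      _ = (powIso A.functor (m + n)).hom ≫ (transMk h comm).app ⟨m + n⟩ := by
        rw [powIso_add_hom, Category.assoc, Category.assoc]
      _ = (powAdd _ m n).hom ≫ (powMap h m ⊗ₘ powMap h n) ≫
          ((powIso B.functor m).hom ⊗ₘ (powIso B.functor n).hom) ≫ μ B.functor ⟨m⟩ ⟨n⟩ := by
        rw [powIso_hom_transMk, powIso_add_hom, ← reassoc_of% powMap_powAdd_hom]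
      _ = _ := by rw [tensorHom_comp_tensorHom_assoc]

/-- The morphism of algebras determined by a morphism of the underlying objects which commutes with
the operations. -/
def homMk : A ⟶ B := Algebra.Hom.mk (transMk h comm)

end Algebra

instance : (toModel C T).Full where
  map_surjective h :=
    ⟨Algebra.homMk (Model.Hom.hom h) (Model.Hom.comm h),
      Model.Hom.ext (Algebra.transMk_app_one (Model.Hom.hom h) (Model.Hom.comm h))⟩

end FullyFaithful

namespace Model

variable {C : Type u} [Category.{v} C] [MonoidalCategory C] [SymmetricCategory C]
  {T : Theory.{w}}

/-- An isomorphism of models, from an isomorphism of the underlying objects commuting with the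
operations. -/
def isoMk {M N : Model C T} (e : M.X ≅ N.X)
    (comm : ∀ {m n : ℕ} (σ : T.Gen m n), M.op σ ≫ powMap e.hom n = powMap e.hom m ≫ N.op σ) :
    M ≅ N where
  hom := ⟨e.hom, comm⟩
  inv := ⟨e.inv, fun {m n} σ => by
    have inv_hom : powMap e.inv m ≫ powMap e.hom m = 𝟙 _ := by
      rw [← powMap_comp, e.inv_hom_id, powMap_id]
    have hom_inv : powMap e.hom n ≫ powMap e.inv n = 𝟙 _ := by
      rw [← powMap_comp, e.hom_inv_id, powMap_id]
    calc N.op σ ≫ powMap e.inv n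
      _ = powMap e.inv m ≫ (powMap e.hom m ≫ N.op σ) ≫ powMap e.inv n := by
        rw [Category.assoc, reassoc_of% inv_hom]
      _ = powMap e.inv m ≫ M.op σ := by
        rw [← comm, Category.assoc, hom_inv, Category.comp_id]⟩
  hom_inv_id := Model.Hom.ext e.hom_inv_id
  inv_hom_id := Model.Hom.ext e.inv_hom_id

variable (M : Model C T)

/-- The functor `n ↦ X^{⊗ n}` out of the presented prop determined by a model on `X`. -/
def functor : T.prop.Ob ⥤ C where
  obj n := pow M.X n.val
  map f := Theory.lift (endProp M.X) M.op
    (fun {_ _ s t} h => by rw [Term.interp_endProp, Term.interp_endProp, M.sat h]) f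
  map_id _ := rfl
  map_comp := by rintro _ _ _ ⟨f⟩ ⟨g⟩; rfl

theorem functor_map_ofTerm {m n : ℕ} (t : Term T.Gen m n) :
    M.functor.map (T.ofTerm t) = t.eval M.X M.op :=
  Term.interp_endProp M.X M.op t

theorem functor_map_eqHom {m n : ℕ} (h : m = n) :
    M.functor.map (X := ⟨m⟩) (Y := ⟨n⟩) (T.prop.eqHom h) =
      eqToHom (congrArg (pow M.X) h) := by
  subst h; rfl

theorem functor_map_tensorHom {m n p q : ℕ} (f : (⟨m⟩ : T.prop.Ob) ⟶ ⟨n⟩)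
    (g : (⟨p⟩ : T.prop.Ob) ⟶ ⟨q⟩) :
    M.functor.map (f ⊗ₘ g) = powTensor (M.functor.map f) (M.functor.map g) := by
  obtain ⟨f⟩ := f
  obtain ⟨g⟩ := g
  rfl

/-- The monoidal structure on the functor determined by a model. -/
def coreMonoidal : M.functor.CoreMonoidal where
  εIso := Iso.refl (𝟙_ C)
  μIso m n := (powAdd M.X m.val n.val).symm
  μIso_hom_natural_left {m n} f p := by
    change M.functor.map f ▷ pow M.X p.val ≫ (powAdd M.X n.val p.val).inv =
      (powAdd M.X m.val p.val).inv ≫ M.functor.map (f ⊗ₘ 𝟙 p)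
    rw [functor_map_tensorHom, CategoryTheory.Functor.map_id]
    refine Eq.trans ?_ (Iso.inv_hom_id_assoc _ _).symm
    exact congrArg (· ≫ _) (tensorHom_id _ _).symm
  μIso_hom_natural_right {m n} p f := by
    change pow M.X p.val ◁ M.functor.map f ≫ (powAdd M.X p.val n.val).inv =
      (powAdd M.X p.val m.val).inv ≫ M.functor.map (𝟙 p ⊗ₘ f)
    rw [functor_map_tensorHom, CategoryTheory.Functor.map_id]
    refine Eq.trans ?_ (Iso.inv_hom_id_assoc _ _).symm
    exact congrArg (· ≫ _) (id_tensorHom _ _).symm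
  associativity _ _ _ :=
    (congrArg (_ ≫ _ ≫ ·) (M.functor_map_eqHom _)).trans (powAdd_inv_assoc M.X _ _ _)
  left_unitality n := by
    have unitality : (powAdd M.X 0 n.val).inv ≫ eqToHom (congrArg (pow M.X) n.val.zero_add) =
        (λ_ (pow M.X n.val)).hom :=
      (Iso.inv_comp_eq _).2 (powAdd_zero_left M.X n.val).symm
    calc (λ_ (pow M.X n.val)).hom
      _ = 𝟙 (𝟙_ C) ▷ pow M.X n.val ≫ (λ_ (pow M.X n.val)).hom := by simp
      _ = _ := congrArg (_ ≫ ·)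
        (unitality.symm.trans (congrArg (_ ≫ ·) (M.functor_map_eqHom _).symm))
  right_unitality n := by
    change (ρ_ (pow M.X n.val)).hom = pow M.X n.val ◁ 𝟙 (𝟙_ C) ≫ (ρ_ (pow M.X n.val)).hom ≫ 𝟙 _
    simp

instance : M.functor.Braided where
  toMonoidal := M.coreMonoidal.toMonoidal
  braided m n := by
    change (powAdd M.X m.val n.val).inv ≫ powBraid M.X m.val n.val =
      (β_ _ _).hom ≫ (powAdd M.X n.val m.val).inv
    rw [powBraid, Iso.inv_hom_id_assoc]

/-- The algebra of the presented prop determined by a model. -/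
def algebra : Algebra T.prop C where
  functor := M.functor

theorem powIso_functor_hom (n : ℕ) :
    (PROP.powIso M.functor n).hom = powMap (λ_ M.X).hom n := by
  induction n with
  | zero => rfl
  | succ n ih =>
    have μ_one : (α_ (pow M.X n) (𝟙_ C) M.X).inv ≫ (ρ_ (pow M.X n)).hom ▷ M.X =
      pow M.X n ◁ (λ_ M.X).hom := triangle_assoc_comp_right _ _
    exact (congrArg (_ ≫ ·) μ_one).trans
      ((MonoidalCategory.tensorHom_def _ _).symm.trans (congrArg (· ⊗ₘ _) ih))

/-- A model is recovered from the algebra it determines, up to `𝟙_ C ⊗ X ≅ X`. -/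
def modelAlgebraIso : M.algebra.model ≅ M :=
  isoMk (λ_ M.X) fun σ =>
    (congrArg (M.algebra.op σ ≫ ·) (M.powIso_functor_hom _).symm).trans
      ((M.algebra.eval_comp_powIso_hom (.gen σ)).trans
        (congrArg₂ (· ≫ ·) (M.powIso_functor_hom _) (M.functor_map_ofTerm (.gen σ))))

end Model

section Presentation

variable {C : Type u} [Category.{v} C] [MonoidalCategory C]

theorem powAdd_inv_eq_eqToHom [IsStrict C] (X : C) (m n : ℕ) :
    ∃ h : pow X m ⊗ pow X n = pow X (m + n), (powAdd X m n).inv = eqToHom h := by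
  induction n with
  | zero => exact IsStrict.rightUnitor (pow X m)
  | succ n ih =>
    obtain ⟨h, e⟩ := ih
    obtain ⟨h', e'⟩ := IsStrict.associator (pow X m) (pow X n) X
    have associator_inv : (α_ (pow X m) (pow X n) X).inv = eqToHom h'.symm := by
      rw [← cancel_epi (α_ (pow X m) (pow X n) X).hom, Iso.hom_inv_id, e', eqToHom_trans,
        eqToHom_refl]
    refine ⟨h'.symm.trans (congrArg (· ⊗ X) h), ?_⟩
    change (α_ (pow X m) (pow X n) X).inv ≫ (powAdd X m n).inv ▷ X = _
    rw [e, associator_inv, eqToHom_whiskerRight, eqToHom_trans]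
    rfl

variable [SymmetricCategory C] {T : Theory.{w}}

theorem Model.isStrict_algebra [IsStrict C] (M : Model C T) :
    Algebra.isStrict T.prop C M.algebra :=
  ⟨⟨rfl, rfl⟩, fun m n => powAdd_inv_eq_eqToHom M.X m.val n.val⟩

instance : (toModel C T).IsEquivalence where
  essSurj := ⟨fun M => ⟨M.algebra, ⟨M.modelAlgebraIso⟩⟩⟩

instance [IsStrict C] : ((Algebra.isStrict T.prop C).ι ⋙ toModel C T).IsEquivalence where
  essSurj := ⟨fun M => ⟨⟨M.algebra, M.isStrict_algebra⟩, ⟨M.modelAlgebraIso⟩⟩⟩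

theorem isPropFor_prop (T : Theory.{w}) : IsPropFor.{v, u} T.prop T := fun C _ _ _ =>
  ⟨⟨(toModel C T).asEquivalence, ⟨Iso.refl _⟩⟩,
    fun _ => ⟨((Algebra.isStrict T.prop C).ι ⋙ toModel C T).asEquivalence, ⟨Iso.refl _⟩⟩⟩

end Presentation

/-! ### Tensor powers of cocommutative comonoids -/

section Comonoids

open ComonObj MonObj

attribute [local instance] ComonObj.instTensorUnit

variable {C : Type u} [Category.{v} C] [MonoidalCategory C]

/-- The first projection from a tensor product whose second factor is a comonoid. -/
def projFst (A B : C) [ComonObj B] : A ⊗ B ⟶ A := A ◁ ε[B] ≫ (ρ_ A).hom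

/-- The second projection from a tensor product whose first factor is a comonoid. -/
def projSnd (A B : C) [ComonObj A] : A ⊗ B ⟶ B := ε[A] ▷ B ≫ (λ_ B).hom

theorem tensorHom_projFst {A A' B B' : C} [ComonObj B] [ComonObj B'] (f : A ⟶ A') (g : B ⟶ B')
    [IsComonHom g] : (f ⊗ₘ g) ≫ projFst A' B' = projFst A B ≫ f := by
  rw [projFst, projFst, tensorHom_comp_whiskerLeft_assoc, IsComonHom.hom_counit]
  simp [MonoidalCategory.tensorHom_def']

theorem tensorHom_projSnd {A A' B B' : C} [ComonObj A] [ComonObj A'] (f : A ⟶ A') (g : B ⟶ B')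
    [IsComonHom f] : (f ⊗ₘ g) ≫ projSnd A' B' = projSnd A B ≫ g := by
  rw [projSnd, projSnd, tensorHom_comp_whiskerRight_assoc, IsComonHom.hom_counit]
  simp [MonoidalCategory.tensorHom_def]

theorem whiskerRight_projFst {A B : C} (f : A ⟶ B) (D : C) [ComonObj D] :
    f ▷ D ≫ projFst B D = projFst A D ≫ f := by
  rw [← tensorHom_id, tensorHom_projFst]

theorem whiskerRight_projSnd {A B : C} [ComonObj A] [ComonObj B] (f : A ⟶ B) [IsComonHom f]
    (D : C) : f ▷ D ≫ projSnd B D = projSnd A D := by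
  rw [← tensorHom_id, tensorHom_projSnd, Category.comp_id]

theorem projFst_unit (A : C) : projFst A (𝟙_ C) = (ρ_ A).hom := by
  change A ◁ 𝟙 (𝟙_ C) ≫ _ = _
  simp

theorem projSnd_unit (A : C) : projSnd (𝟙_ C) A = (λ_ A).hom := by
  change 𝟙 (𝟙_ C) ▷ A ≫ _ = _
  simp

theorem comul_projFst (A : C) [ComonObj A] : Δ[A] ≫ projFst A A = 𝟙 A := by
  simp [projFst]

theorem comul_projSnd (A : C) [ComonObj A] : Δ[A] ≫ projSnd A A = 𝟙 A := by
  simp [projSnd]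

theorem associator_projSnd (A B D : C) [ComonObj A] :
    (α_ A B D).hom ≫ projSnd A (B ⊗ D) = projSnd A B ▷ D := by
  simp [projSnd]

instance isComonHom_counit (A : C) [ComonObj A] : IsComonHom ε[A] :=
  (default : Comon.mk A ⟶ Comon.trivial C).isComonHom_hom

variable [SymmetricCategory C]

theorem associator_projFst (A B D : C) [ComonObj B] [ComonObj D] :
    (α_ A B D).hom ≫ projFst A (B ⊗ D) = projFst (A ⊗ B) D ≫ projFst A B := by
  rw [projFst, projFst, projFst, Comon.tensorObj_counit, MonoidalCategory.tensorHom_def']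
  simp

theorem braiding_projFst (A B : C) [ComonObj A] :
    (β_ A B).hom ≫ projFst B A = projSnd A B := by
  rw [projFst, projSnd, ← BraidedCategory.braiding_naturality_left_assoc, braiding_rightUnitor]

theorem braiding_projSnd (A B : C) [ComonObj B] :
    (β_ A B).hom ≫ projSnd B A = projFst A B := by
  rw [projFst, projSnd, ← BraidedCategory.braiding_naturality_right_assoc, braiding_leftUnitor]

instance isComonHom_tensorHom {A B A' B' : C} [ComonObj A] [ComonObj B] [ComonObj A']
    [ComonObj B'] (f : A ⟶ A') (g : B ⟶ B') [IsComonHom f] [IsComonHom g] :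
    IsComonHom (f ⊗ₘ g) := by
  let f' : Comon.mk A ⟶ Comon.mk A' := ⟨f⟩
  let g' : Comon.mk B ⟶ Comon.mk B' := ⟨g⟩
  have := (f' ⊗ₘ g').isComonHom_hom
  rwa [Comon.monoidal_tensorHom_hom] at this

instance isComonHom_whiskerLeft (A : C) {B D : C} [ComonObj A] [ComonObj B] [ComonObj D]
    (f : B ⟶ D) [IsComonHom f] : IsComonHom (A ◁ f) := by
  rw [← id_tensorHom]
  infer_instance

instance isComonHom_whiskerRight {A B : C} [ComonObj A] [ComonObj B] (f : A ⟶ B) [IsComonHom f]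
    (D : C) [ComonObj D] : IsComonHom (f ▷ D) := by
  rw [← tensorHom_id]
  infer_instance

instance isComonHom_associator (A B D : C) [ComonObj A] [ComonObj B] [ComonObj D] :
    IsComonHom (α_ A B D).hom where
  hom_counit := by
    simp only [Comon.tensorObj_counit]
    rw [← tensorHom_comp_whiskerLeft, Category.assoc, ← associator_naturality_assoc,
      ← tensorHom_comp_whiskerRight, Category.assoc]
    congr 1
    monoidal
  hom_comul := by
    simp only [Comon.tensorObj_comul]
    rw [← tensorHom_comp_whiskerLeft, Category.assoc, ← associator_naturality_assoc,
      ← tensorHom_comp_whiskerRight, Category.assoc, Category.assoc, tensor_associativity]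

instance isComonHom_leftUnitor (A : C) [ComonObj A] : IsComonHom (λ_ A).hom where
  hom_counit := by
    rw [Comon.tensorObj_counit]
    change _ = (𝟙 (𝟙_ C) ⊗ₘ _) ≫ _
    simp
  hom_comul := by
    rw [Comon.tensorObj_comul, Category.assoc]
    change _ = ((λ_ (𝟙_ C)).inv ⊗ₘ _) ≫ _
    rw [MonoidalCategory.tensorHom_def', Category.assoc, ← tensor_left_unitality,
      leftUnitor_naturality]

instance isComonHom_rightUnitor (A : C) [ComonObj A] : IsComonHom (ρ_ A).hom where
  hom_counit := by
    rw [Comon.tensorObj_counit]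
    change _ = (_ ⊗ₘ 𝟙 (𝟙_ C)) ≫ _
    rw [tensorHom_id, unitors_equal, rightUnitor_naturality]
  hom_comul := by
    rw [Comon.tensorObj_comul, Category.assoc]
    change _ = (_ ⊗ₘ (λ_ (𝟙_ C)).inv) ≫ _
    rw [MonoidalCategory.tensorHom_def, Category.assoc, ← tensor_right_unitality,
      rightUnitor_naturality]

theorem braiding_tensorμ (X₁ X₂ Y₁ Y₂ : C) :
    (β_ (X₁ ⊗ X₂) (Y₁ ⊗ Y₂)).hom ≫ tensorμ Y₁ Y₂ X₁ X₂ =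
      tensorμ X₁ X₂ Y₁ Y₂ ≫ ((β_ X₁ Y₁).hom ⊗ₘ (β_ X₂ Y₂).hom) := by
  simp [tensorμ, SymmetricCategory.braiding_swap_eq_inv_braiding Y₂ X₁,
    MonoidalCategory.tensorHom_def]

instance isComonHom_braiding (A B : C) [ComonObj A] [ComonObj B] : IsComonHom (β_ A B).hom where
  hom_counit := by
    rw [Comon.tensorObj_counit, Comon.tensorObj_counit,
      ← BraidedCategory.braiding_naturality_assoc, braiding_leftUnitor, unitors_equal]
  hom_comul := by
    rw [Comon.tensorObj_comul, Comon.tensorObj_comul, Category.assoc, ← braiding_tensorμ,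
      BraidedCategory.braiding_naturality_assoc]

instance isComonHom_comul (A : C) [ComonObj A] [IsCommComonObj A] : IsComonHom Δ[A] where
  hom_counit := by
    rw [Comon.tensorObj_counit]
    simp [unitors_equal]
  hom_comul := by
    -- the interchange law for the commutative monoid `A` in the opposite category
    let : MonObj (Opposite.op A) := Comon.ComonToMonOpOpObjMon (Comon.mk A)
    have : IsCommMonObj (Opposite.op A) := ⟨Quiver.Hom.unop_inj (IsCommComonObj.comul_comm A)⟩
    have interchange := congrArg Quiver.Hom.unop (MonObj.mul_mul_mul_comm (Opposite.op A))
    rw [Comon.tensorObj_comul', ← Category.assoc]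
    exact interchange

instance isComonHom_projFst (A B : C) [ComonObj A] [ComonObj B] : IsComonHom (projFst A B) :=
  inferInstanceAs (IsComonHom (A ◁ ε[B] ≫ (ρ_ A).hom))

instance isComonHom_projSnd (A B : C) [ComonObj A] [ComonObj B] : IsComonHom (projSnd A B) :=
  inferInstanceAs (IsComonHom (ε[A] ▷ B ≫ (λ_ B).hom))

theorem tensorμ_unitors (A B : C) :
    tensorμ A (𝟙_ C) (𝟙_ C) B ≫ ((ρ_ A).hom ⊗ₘ (λ_ B).hom) = (ρ_ A).hom ⊗ₘ (λ_ B).hom := by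
  have braiding_unit : (β_ (𝟙_ C) (𝟙_ C)).hom = 𝟙 _ := by
    rw [braiding_tensorUnit_left, unitors_equal, Iso.hom_inv_id]
  rw [tensorμ, braiding_unit]
  monoidal

theorem comul_projFst_projSnd (A B : C) [ComonObj A] [ComonObj B] :
    Δ[A ⊗ B] ≫ (projFst A B ⊗ₘ projSnd A B) = 𝟙 (A ⊗ B) := by
  rw [Comon.tensorObj_comul, projFst, projSnd, ← tensorHom_comp_tensorHom, ← id_tensorHom,
    ← tensorHom_id, Category.assoc, ← tensorμ_natural_assoc, tensorHom_comp_tensorHom_assoc,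
    id_tensorHom, tensorHom_id, comul_counit, counit_comul, tensorμ_unitors,
    tensorHom_comp_tensorHom, Iso.inv_hom_id, Iso.inv_hom_id, id_tensorHom_id]

theorem eq_comul_comp_proj {D A B : C} [ComonObj D] [ComonObj A] [ComonObj B] (h : D ⟶ A ⊗ B)
    [IsComonHom h] : h = Δ[D] ≫ (h ≫ projFst A B ⊗ₘ h ≫ projSnd A B) := by
  rw [← tensorHom_comp_tensorHom, ← IsComonHom.hom_comul_assoc, comul_projFst_projSnd,
    Category.comp_id]

end Comonoids

section Convolution

open ComonObj MonObj

variable {C : Type u} [Category.{v} C] [MonoidalCategory C] [SymmetricCategory C]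

/-- The convolution product on morphisms from a cocommutative comonoid to a commutative monoid. -/
@[reducible]
def convCommMonoid (A X : C) [ComonObj A] [IsCommComonObj A] [MonObj X] [IsCommMonObj X] :
    CommMonoid (A ⟶ X) where
  toMonoid := inferInstanceAs (Monoid (Conv A X))
  mul_comm f g := by
    change Δ[A] ≫ f ▷ A ≫ X ◁ g ≫ μ[X] = Δ[A] ≫ g ▷ A ≫ X ◁ f ≫ μ[X]
    rw [← MonoidalCategory.tensorHom_def_assoc, ← MonoidalCategory.tensorHom_def_assoc,
      ← IsCommComonObj.comul_comm_assoc, ← BraidedCategory.braiding_naturality_assoc,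
      IsCommMonObj.mul_comm]

attribute [local instance] convCommMonoid ComonObj.instTensorUnit

variable {A B X : C} [ComonObj A] [IsCommComonObj A] [ComonObj B] [IsCommComonObj B]

section CommMon

variable [MonObj X] [IsCommMonObj X]

theorem conv_mul_def (f g : A ⟶ X) : f * g = Δ[A] ≫ (f ⊗ₘ g) ≫ μ[X] := by
  change Δ[A] ≫ f ▷ A ≫ X ◁ g ≫ μ[X] = _
  rw [← MonoidalCategory.tensorHom_def_assoc]

theorem conv_one_def : (1 : A ⟶ X) = ε[A] ≫ η[X] := rfl

variable (X) in
/-- Precomposition with a comonoid morphism, as a homomorphism of convolution monoids. -/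
def convPrecomp (f : A ⟶ B) [IsComonHom f] : (B ⟶ X) →* (A ⟶ X) where
  toFun g := f ≫ g
  map_one' := IsComonHom.hom_counit_assoc f _
  map_mul' g h := by
    rw [conv_mul_def, conv_mul_def, IsComonHom.hom_comul_assoc, tensorHom_comp_tensorHom_assoc]

theorem comp_prod {J : Type*} (f : A ⟶ B) [IsComonHom f] (g : J → (B ⟶ X)) (S : Finset J) :
    f ≫ ∏ i ∈ S, g i = ∏ i ∈ S, f ≫ g i :=
  map_prod (convPrecomp X f) g S

theorem projFst_mul_projSnd [ComonObj X] [IsCommComonObj X] (f : A ⟶ X) :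
    (projFst A X ≫ f) * projSnd A X = f ▷ X ≫ μ[X] := by
  rw [conv_mul_def, ← tensorHom_comp_whiskerRight_assoc, ← Category.assoc, comul_projFst_projSnd,
    Category.id_comp]

end CommMon

/-- The special law for an object carrying both a monoid and a comonoid structure. -/
class IsSpecial (X : C) [ComonObj X] [MonObj X] : Prop where
  comul_mul : Δ[X] ≫ μ[X] = 𝟙 X

theorem isIdempotentElem_conv [ComonObj X] [MonObj X] [IsCommMonObj X] [IsSpecial X] (f : A ⟶ X)
    [IsComonHom f] : IsIdempotentElem f := by
  rw [IsIdempotentElem, conv_mul_def, ← IsComonHom.hom_comul_assoc, IsSpecial.comul_mul,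
    Category.comp_id]

variable [BimonObj X]

instance isComonHom_mul : IsComonHom μ[X] where
  hom_comul := by simp

instance isComonHom_one : IsComonHom η[X] where
  hom_counit := BimonObj.one_counit X
  hom_comul := BimonObj.one_comul X

instance isComonHom_conv_prod [IsCommMonObj X] {J : Type*} (g : J → (A ⟶ X))
    [∀ i, IsComonHom (g i)] (S : Finset J) : IsComonHom (∏ i ∈ S, g i) := by
  refine Finset.prod_induction g IsComonHom (fun f g _ _ => ?_) ?_ fun i _ => inferInstance
  · rw [conv_mul_def]
    infer_instance
  · rw [conv_one_def]
    infer_instance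

end Convolution

section PowComonoid

open ComonObj

attribute [local instance] ComonObj.instTensorUnit

variable {C : Type u} [Category.{v} C] [MonoidalCategory C] [SymmetricCategory C]

section

variable (X : C) [ComonObj X]

instance powComonObj : ∀ n : ℕ, ComonObj (pow X n)
  | 0 => inferInstanceAs (ComonObj (𝟙_ C))
  | n + 1 =>
    have := powComonObj n
    inferInstanceAs (ComonObj (pow X n ⊗ X))

instance isCommComonObj_pow [IsCommComonObj X] : ∀ n : ℕ, IsCommComonObj (pow X n)
  | 0 => inferInstanceAs (IsCommComonObj (𝟙_ C))
  | n + 1 =>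
    have := isCommComonObj_pow n
    inferInstanceAs (IsCommComonObj (pow X n ⊗ X))

instance isComonHom_powAdd (m n : ℕ) : IsComonHom (powAdd X m n).hom := by
  induction n with
  | zero => exact inferInstanceAs (IsComonHom (ρ_ (pow X m)).inv)
  | succ n ih =>
    exact inferInstanceAs (IsComonHom ((powAdd X m n).hom ▷ X ≫ (α_ (pow X m) (pow X n) X).hom))

instance isComonHom_powBraid (m n : ℕ) : IsComonHom (powBraid X m n) :=
  inferInstanceAs (IsComonHom (_ ≫ _ ≫ (powAdd X n m).inv))

instance isComonHom_powTensor {m n p q : ℕ} (f : pow X m ⟶ pow X n) (g : pow X p ⟶ pow X q)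
    [IsComonHom f] [IsComonHom g] : IsComonHom (powTensor f g) :=
  inferInstanceAs (IsComonHom (_ ≫ _ ≫ (powAdd X n q).inv))

/-- The projections from a tensor power of a comonoid. -/
def powProj : ∀ n : ℕ, Fin n → (pow X n ⟶ X)
  | 0 => Fin.elim0
  | n + 1 => Fin.lastCases (motive := fun _ => pow X (n + 1) ⟶ X) (projSnd (pow X n) X)
      fun i => projFst (pow X n) X ≫ powProj n i

theorem powProj_last (n : ℕ) : powProj X (n + 1) (Fin.last n) = projSnd (pow X n) X :=
  Fin.lastCases_last

theorem powProj_castSucc (n : ℕ) (i : Fin n) :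
    powProj X (n + 1) i.castSucc = projFst (pow X n) X ≫ powProj X n i :=
  Fin.lastCases_castSucc _

theorem powProj_one : powProj X 1 0 = (λ_ X).hom :=
  (powProj_last X 0).trans (projSnd_unit X)

theorem powProj_two_zero : powProj X 2 0 = projFst (𝟙_ C ⊗ X) X ≫ (λ_ X).hom :=
  (powProj_castSucc X 1 0).trans (congrArg (_ ≫ ·) (powProj_one X))

theorem powProj_two_one : powProj X 2 1 = projSnd (𝟙_ C ⊗ X) X := powProj_last X 1

instance isComonHom_powProj (n : ℕ) (i : Fin n) : IsComonHom (powProj X n i) := by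
  induction n with
  | zero => exact i.elim0
  | succ n ih =>
    induction i using Fin.lastCases with
    | last => exact powProj_last X n ▸ isComonHom_projSnd (pow X n) X
    | cast i =>
      rw [powProj_castSucc]
      exact inferInstanceAs (IsComonHom (projFst (pow X n) X ≫ powProj X n i))

theorem powAdd_hom_projFst_powProj (m n : ℕ) (i : Fin m) :
    (powAdd X m n).hom ≫ projFst (pow X m) (pow X n) ≫ powProj X m i =
      powProj X (m + n) (Fin.castAdd n i) := by
  induction n with
  | zero =>
    change (ρ_ _).inv ≫ projFst (pow X m) (𝟙_ C) ≫ powProj X m i = powProj X m i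
    rw [projFst_unit, Iso.inv_hom_id_assoc]
  | succ n ih =>
    refine Eq.trans ?_ (powProj_castSucc X (m + n) (Fin.castAdd n i)).symm
    rw [← ih]
    change ((powAdd X m n).hom ▷ X ≫ (α_ (pow X m) (pow X n) X).hom) ≫
      projFst (pow X m) (pow X n ⊗ X) ≫ _ = _
    rw [Category.assoc, reassoc_of% associator_projFst, reassoc_of% whiskerRight_projFst]

theorem powAdd_hom_projSnd_powProj (m n : ℕ) (i : Fin n) :
    (powAdd X m n).hom ≫ projSnd (pow X m) (pow X n) ≫ powProj X n i =
      powProj X (m + n) (Fin.natAdd m i) := by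
  induction n with
  | zero => exact i.elim0
  | succ n ih =>
    induction i using Fin.lastCases with
    | last =>
      refine Eq.trans ?_ (powProj_last X (m + n)).symm
      rw [powProj_last]
      change ((powAdd X m n).hom ▷ X ≫ (α_ (pow X m) (pow X n) X).hom) ≫
        projSnd (pow X m) (pow X n ⊗ X) ≫ _ = _
      rw [Category.assoc, reassoc_of% associator_projSnd, whiskerRight_projSnd,
        whiskerRight_projSnd]
    | cast i =>
      refine Eq.trans ?_ (powProj_castSucc X (m + n) (Fin.natAdd m i)).symm
      rw [powProj_castSucc, ← ih]
      change ((powAdd X m n).hom ▷ X ≫ (α_ (pow X m) (pow X n) X).hom) ≫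
        projSnd (pow X m) (pow X n ⊗ X) ≫ _ = _
      rw [Category.assoc, reassoc_of% associator_projSnd, reassoc_of% whiskerRight_projFst,
        reassoc_of% whiskerRight_projFst]

variable {X}

theorem powTensor_powProj_castAdd {m n p q : ℕ} (f : pow X m ⟶ pow X n) (g : pow X p ⟶ pow X q)
    [IsComonHom g] (j : Fin n) : powTensor f g ≫ powProj X (n + q) (Fin.castAdd q j) =
      (powAdd X m p).hom ≫ projFst (pow X m) (pow X p) ≫ f ≫ powProj X n j := by
  rw [← powAdd_hom_projFst_powProj, reassoc_of% powTensor_powAdd_hom, reassoc_of% tensorHom_projFst]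

theorem powTensor_powProj_natAdd {m n p q : ℕ} (f : pow X m ⟶ pow X n) (g : pow X p ⟶ pow X q)
    [IsComonHom f] (j : Fin q) : powTensor f g ≫ powProj X (n + q) (Fin.natAdd n j) =
      (powAdd X m p).hom ≫ projSnd (pow X m) (pow X p) ≫ g ≫ powProj X q j := by
  rw [← powAdd_hom_projSnd_powProj, reassoc_of% powTensor_powAdd_hom, reassoc_of% tensorHom_projSnd]

theorem powBraid_powProj (m n : ℕ) (j : Fin (n + m)) : powBraid X m n ≫ powProj X (n + m) j =
    powProj X (m + n) (finSumFinEquiv (finSumFinEquiv.symm j).swap) := by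
  induction j using Fin.addCases with
  | left j =>
    rw [← powAdd_hom_projFst_powProj, reassoc_of% powBraid_powAdd_hom, reassoc_of% braiding_projFst,
      powAdd_hom_projSnd_powProj]
    simp
  | right j =>
    rw [← powAdd_hom_projSnd_powProj, reassoc_of% powBraid_powAdd_hom, reassoc_of% braiding_projSnd,
      powAdd_hom_projFst_powProj]
    simp

variable {A : C} [ComonObj A]

/-- The morphism from a comonoid to a tensor power with the given components. -/
def powLift : ∀ {n : ℕ}, (Fin n → (A ⟶ X)) → (A ⟶ pow X n)
  | 0, _ => ε[A]
  | n + 1, g => (Δ[A] ≫ (powLift (fun i => g i.castSucc) ⊗ₘ g (Fin.last n)) : A ⟶ pow X n ⊗ X)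

theorem powLift_comp_powProj {n : ℕ} (f : A ⟶ pow X n) [IsComonHom f] :
    powLift (fun i => f ≫ powProj X n i) = f := by
  induction n with
  | zero => exact (IsComonHom.hom_counit f).symm.trans (Category.comp_id f)
  | succ n ih =>
    let f' : A ⟶ pow X n ⊗ X := f
    have : IsComonHom f' := ‹IsComonHom f›
    have init (i : Fin n) : f ≫ powProj X (n + 1) i.castSucc =
        (f' ≫ projFst (pow X n) X) ≫ powProj X n i := by
      rw [powProj_castSucc]
      exact (Category.assoc _ _ _).symm
    have last : f ≫ powProj X (n + 1) (Fin.last n) = f' ≫ projSnd (pow X n) X :=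
      congrArg (f ≫ ·) (powProj_last X n)
    change Δ[A] ≫ (powLift (fun i => f ≫ powProj X (n + 1) i.castSucc) ⊗ₘ _) = f'
    simp only [init, last]
    rw [ih (f' ≫ projFst (pow X n) X), ← eq_comul_comp_proj f']

theorem powProj_ext {n : ℕ} {f g : A ⟶ pow X n} [IsComonHom f] [IsComonHom g]
    (h : ∀ i, f ≫ powProj X n i = g ≫ powProj X n i) : f = g := by
  rw [← powLift_comp_powProj f, ← powLift_comp_powProj g, funext h]

variable [IsCommComonObj A] {n : ℕ} (g : Fin n → (A ⟶ X)) [∀ i, IsComonHom (g i)]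

instance isComonHom_powLift : IsComonHom (powLift g) := by
  induction n with
  | zero => exact inferInstanceAs (IsComonHom ε[A])
  | succ n ih =>
    have := ih fun i => g i.castSucc
    exact inferInstanceAs (IsComonHom (Δ[A] ≫ (powLift (fun i => g i.castSucc) ⊗ₘ g (Fin.last n))))

theorem powLift_powProj (j : Fin n) : powLift g ≫ powProj X n j = g j := by
  induction n with
  | zero => exact j.elim0
  | succ n ih =>
    have := isComonHom_powLift fun i => g i.castSucc
    induction j using Fin.lastCases with
    | last =>
      rw [powProj_last]
      change (Δ[A] ≫ (powLift (fun i => g i.castSucc) ⊗ₘ g (Fin.last n))) ≫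
        projSnd (pow X n) X = _
      rw [Category.assoc, tensorHom_projSnd, reassoc_of% comul_projSnd]
    | cast j =>
      rw [powProj_castSucc]
      change (Δ[A] ≫ (powLift (fun i => g i.castSucc) ⊗ₘ g (Fin.last n))) ≫
        projFst (pow X n) X ≫ powProj X n j = _
      rw [Category.assoc, reassoc_of% tensorHom_projFst, reassoc_of% comul_projFst,
        ih fun i => g i.castSucc]

end

end PowComonoid

/-! ### Morphisms determined by relations -/

section RelationMorphisms

open ComonObj MonObj

attribute [local instance] ComonObj.instTensorUnit convCommMonoid

theorem prod_ite_of_isIdempotentElem {M J : Type*} [CommMonoid M] {a : M}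
    (ha : IsIdempotentElem a) (S : Finset J) (p : J → Prop) [DecidablePred p] :
    (∏ j ∈ S, if p j then a else 1) = if ∃ j ∈ S, p j then a else 1 := by
  rw [← Finset.prod_filter, Finset.prod_const]
  split_ifs with h
  · exact ha.pow_eq (Finset.card_ne_zero.2 (Finset.filter_nonempty_iff.2 h))
  · rw [← Finset.filter_nonempty_iff, Finset.not_nonempty_iff_eq_empty] at h
    rw [h, Finset.card_empty, pow_zero]

variable {C : Type u} [Category.{v} C] [MonoidalCategory C] [SymmetricCategory C]
  (X : C) [BimonObj X] [IsCommMonObj X] [IsCommComonObj X]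

open Classical in
/-- The convolution product of a set of projections from a tensor power. -/
noncomputable def relProj {m : ℕ} (p : Fin m → Prop) : pow X m ⟶ X :=
  ∏ i with p i, powProj X m i

instance isComonHom_relProj {m : ℕ} (p : Fin m → Prop) : IsComonHom (relProj X p) :=
  isComonHom_conv_prod _ _

theorem relProj_eq {m : ℕ} (i : Fin m) : relProj X (fun k => k = i) = powProj X m i := by
  simp [relProj, Finset.filter_eq']

theorem relProj_eq_prod_ite {m : ℕ} (p : Fin m → Prop) [DecidablePred p] :
    relProj X p = ∏ i, if p i then powProj X m i else 1 := by
  rw [relProj, ← Finset.prod_filter]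
  congr

theorem powAdd_hom_projFst_relProj {m n : ℕ} (p : Fin m → Prop) :
    (powAdd X m n).hom ≫ projFst (pow X m) (pow X n) ≫ relProj X p =
      relProj X (Fin.addCases p fun _ => False) := by
  classical
  rw [relProj, comp_prod, comp_prod, relProj_eq_prod_ite, Fin.prod_univ_add, Finset.prod_filter]
  simp [powAdd_hom_projFst_powProj]

theorem powAdd_hom_projSnd_relProj {m n : ℕ} (p : Fin n → Prop) :
    (powAdd X m n).hom ≫ projSnd (pow X m) (pow X n) ≫ relProj X p =
      relProj X (Fin.addCases (fun _ => False) p) := by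
  classical
  rw [relProj, comp_prod, comp_prod, relProj_eq_prod_ite, Fin.prod_univ_add, Finset.prod_filter]
  simp [powAdd_hom_projSnd_powProj]

/-- The morphism between tensor powers determined by a relation: its component at `j` is the
convolution product of the projections to the `i` related to `j`. -/
noncomputable def relHom {m n : ℕ} (R : Fin m → Fin n → Prop) : pow X m ⟶ pow X n :=
  powLift fun j => relProj X (R · j)

instance isComonHom_relHom {m n : ℕ} (R : Fin m → Fin n → Prop) : IsComonHom (relHom X R) :=
  isComonHom_powLift _

theorem relHom_powProj {m n : ℕ} (R : Fin m → Fin n → Prop) (j : Fin n) :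
    relHom X R ≫ powProj X n j = relProj X (R · j) :=
  powLift_powProj _ j

variable {X} in
theorem eq_relHom {m n : ℕ} {f : pow X m ⟶ pow X n} [IsComonHom f] {R : Fin m → Fin n → Prop}
    (h : ∀ j, f ≫ powProj X n j = relProj X (R · j)) : f = relHom X R :=
  powProj_ext fun j => (h j).trans (relHom_powProj X R j).symm

theorem id_eq_relHom (n : ℕ) : 𝟙 (pow X n) = relHom X (RelProp.data.id n) :=
  eq_relHom fun j => (Category.id_comp _).trans (relProj_eq X j).symm

theorem powBraid_eq_relHom (m n : ℕ) : powBraid X m n = relHom X (RelProp.data.braid m n) :=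
  eq_relHom fun j => by
    have braid_iff (i : Fin (m + n)) : RelProp.data.braid m n i j ↔
        i = finSumFinEquiv (finSumFinEquiv.symm j).swap := by
      rw [← Equiv.symm_apply_eq, ← Sum.swap_swap (finSumFinEquiv.symm i),
        Sum.swap_leftInverse.injective.eq_iff]
      rfl
    simp only [braid_iff, relProj_eq, powBraid_powProj]

theorem powTensor_relHom {m n p q : ℕ} (R : Fin m → Fin n → Prop) (S : Fin p → Fin q → Prop) :
    powTensor (relHom X R) (relHom X S) = relHom X (RelProp.data.tensor R S) :=
  eq_relHom fun j => by
    induction j using Fin.addCases with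
    | left j =>
      rw [powTensor_powProj_castAdd, relHom_powProj, powAdd_hom_projFst_relProj]
      congr 1
      funext i
      induction i using Fin.addCases with
      | left i => simpa using (RelProp.tensor_ll R S i j).symm
      | right i => simpa using (RelProp.tensor_rl R S i j).symm
    | right j =>
      rw [powTensor_powProj_natAdd, relHom_powProj, powAdd_hom_projSnd_relProj]
      congr 1
      funext i
      induction i using Fin.addCases with
      | left i => simpa using (RelProp.tensor_lr R S i j).symm
      | right i => simpa using (RelProp.tensor_rr R S i j).symm

theorem relHom_comp [IsSpecial X] {l m n : ℕ} (R : Fin l → Fin m → Prop)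
    (S : Fin m → Fin n → Prop) : relHom X R ≫ relHom X S = relHom X (RelProp.data.comp R S) :=
  eq_relHom fun k => by
    classical
    rw [Category.assoc, relHom_powProj, relProj, comp_prod]
    calc ∏ j with S j k, relHom X R ≫ powProj X m j
      _ = ∏ j with S j k, ∏ i, if R i j then powProj X l i else 1 := by
        simp only [relHom_powProj, relProj_eq_prod_ite]
      _ = ∏ i, ∏ j with S j k, if R i j then powProj X l i else 1 := Finset.prod_comm
      _ = ∏ i, if ∃ j, R i j ∧ S j k then powProj X l i else 1 := by
        simp only [prod_ite_of_isIdempotentElem (isIdempotentElem_conv _), Finset.mem_filter_univ,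
          and_comm]
      _ = relProj X (RelProp.data.comp R S · k) := (relProj_eq_prod_ite X _).symm

section Injectivity

variable (h : 𝟙 X ≠ ε[X] ≫ η[X])

include h

theorem relProj_injective (m : ℕ) :
    Function.Injective (relProj X : (Fin m → Prop) → (pow X m ⟶ X)) := by
  classical
  intro p q hpq
  funext i
  let inc : X ⟶ pow X m := powLift fun k => if k = i then 𝟙 X else 1
  have (k : Fin m) : IsComonHom (if k = i then 𝟙 X else (1 : X ⟶ X)) := by
    split_ifs
    · infer_instance
    · exact inferInstanceAs (IsComonHom (ε[X] ≫ η[X]))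
  have inc_relProj (p : Fin m → Prop) : inc ≫ relProj X p = if p i then 𝟙 X else 1 := by
    simp only [relProj, comp_prod, inc, powLift_powProj, Finset.prod_ite_eq',
      Finset.mem_filter_univ]
  have ite_eq := (inc_relProj p).symm.trans ((congrArg (inc ≫ ·) hpq).trans (inc_relProj q))
  have one_ne : (1 : X ⟶ X) ≠ 𝟙 X := h.symm
  by_cases hp : p i <;> by_cases hq : q i <;> simp_all

theorem relHom_injective (m n : ℕ) :
    Function.Injective (relHom X : (Fin m → Fin n → Prop) → (pow X m ⟶ pow X n)) := by
  intro R S hRS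
  have component (j : Fin n) : (R · j) = (S · j) :=
    relProj_injective X h m (by rw [← relHom_powProj, hRS, relHom_powProj])
  exact funext fun i => funext fun j => congrFun (component j) i

end Injectivity

end RelationMorphisms

/-! ### Terms and the relations they denote -/

namespace SBB

open ComonObj MonObj

/-- The interpretation of every generator as the total relation. -/
def relOp : ∀ {m n : ℕ}, Gen m n → relProp.Hom m n := fun _ _ _ => True

/-- The relation denoted by a term. -/
def rel {m n : ℕ} (t : Term Gen m n) : Fin m → Fin n → Prop := t.interp relProp relOp

/-- A decision procedure for the relation denoted by a term. -/
@[reducible]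
def decidableRel : ∀ {m n : ℕ} (t : Term Gen m n) (i : Fin m) (j : Fin n), Decidable (rel t i j)
  | _, _, .gen _, _, _ => .isTrue trivial
  | _, _, .id _, i, j => inferInstanceAs (Decidable (i = j))
  | _, _, .braid _ _, i, j =>
    inferInstanceAs (Decidable ((finSumFinEquiv.symm i).swap = finSumFinEquiv.symm j))
  | _, _, .comp s t, i, j =>
    have := decidableRel s
    have := decidableRel t
    inferInstanceAs (Decidable (∃ k, rel s i k ∧ rel t k j))
  | _, _, .tensor s t, i, j =>
    have : ∀ i j, Decidable (rel s i j) := decidableRel s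
    have : ∀ i j, Decidable (rel t i j) := decidableRel t
    Sum.instDecidableLiftRel (r := rel s) (s := rel t) (finSumFinEquiv.symm i)
      (finSumFinEquiv.symm j)

attribute [local instance] decidableRel in
theorem rel_sat {m n : ℕ} {s t : Term Gen m n} (h : Eqn s t) : rel s = rel t := by
  cases h <;> exact RelProp.hom_ext (by decide)

/-- The morphism of props sending a term to the relation it denotes. -/
def toRel : sbb.prop ⟶ relProp := sbb.desc relProp relOp rel_sat

section Evaluation

attribute [local instance] ComonObj.instTensorUnit convCommMonoid

variable {C : Type u} [Category.{v} C] [MonoidalCategory C] [SymmetricCategory C]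

/-- The operations on the tensor powers of an object carrying a monoid and a comonoid structure. -/
def opOf (X : C) [ComonObj X] [MonObj X] : ∀ {m n : ℕ}, Gen m n → (pow X m ⟶ pow X n)
  | _, _, .mul => ((λ_ X).hom ▷ X ≫ μ[X] ≫ (λ_ X).inv : (𝟙_ C ⊗ X) ⊗ X ⟶ 𝟙_ C ⊗ X)
  | _, _, .unit => (η[X] ≫ (λ_ X).inv : 𝟙_ C ⟶ 𝟙_ C ⊗ X)
  | _, _, .comul => ((λ_ X).hom ≫ Δ[X] ≫ (λ_ X).inv ▷ X : 𝟙_ C ⊗ X ⟶ (𝟙_ C ⊗ X) ⊗ X)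
  | _, _, .counit => ((λ_ X).hom ≫ ε[X] : 𝟙_ C ⊗ X ⟶ 𝟙_ C)

theorem opOf_comul_powProj (X : C) [ComonObj X] [MonObj X] (j : Fin 2) :
    opOf X .comul ≫ powProj X 2 j = powProj X 1 0 := by
  rw [powProj_one]
  fin_cases j
  · refine (congrArg (_ ≫ ·) (powProj_two_zero X)).trans ?_
    change ((λ_ X).hom ≫ Δ[X] ≫ (λ_ X).inv ▷ X) ≫ projFst (𝟙_ C ⊗ X) X ≫ (λ_ X).hom = _
    simp only [Category.assoc]
    rw [reassoc_of% whiskerRight_projFst, reassoc_of% comul_projFst, Iso.inv_hom_id,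
      Category.comp_id]
  · refine (congrArg (_ ≫ ·) (powProj_two_one X)).trans ?_
    change ((λ_ X).hom ≫ Δ[X] ≫ (λ_ X).inv ▷ X) ≫ projSnd (𝟙_ C ⊗ X) X = _
    simp only [Category.assoc]
    rw [whiskerRight_projSnd, comul_projSnd, Category.comp_id]

variable (X : C) [BimonObj X] [IsCommComonObj X]

instance isComonHom_opOf {m n : ℕ} (σ : Gen m n) : IsComonHom (opOf X σ) :=
  match σ with
  | .mul => inferInstanceAs (IsComonHom
      ((λ_ X).hom ▷ X ≫ μ[X] ≫ (λ_ X).inv : (𝟙_ C ⊗ X) ⊗ X ⟶ 𝟙_ C ⊗ X))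
  | .unit => inferInstanceAs (IsComonHom (η[X] ≫ (λ_ X).inv : 𝟙_ C ⟶ 𝟙_ C ⊗ X))
  | .comul => inferInstanceAs (IsComonHom
      ((λ_ X).hom ≫ Δ[X] ≫ (λ_ X).inv ▷ X : 𝟙_ C ⊗ X ⟶ (𝟙_ C ⊗ X) ⊗ X))
  | .counit => inferInstanceAs (IsComonHom ((λ_ X).hom ≫ ε[X] : 𝟙_ C ⊗ X ⟶ 𝟙_ C))

variable [IsCommMonObj X]

theorem opOf_mul_powProj : opOf X .mul ≫ powProj X 1 0 = powProj X 2 0 * powProj X 2 1 := by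
  rw [powProj_two_zero, powProj_two_one, powProj_one]
  refine Eq.trans ?_ (projFst_mul_projSnd (λ_ X).hom).symm
  change ((λ_ X).hom ▷ X ≫ μ[X] ≫ (λ_ X).inv) ≫ (λ_ X).hom = _
  simp

theorem opOf_unit_powProj : opOf X .unit ≫ powProj X 1 0 = 1 := by
  rw [powProj_one]
  change (η[X] ≫ (λ_ X).inv) ≫ (λ_ X).hom = 𝟙 (𝟙_ C) ≫ η[X]
  simp

theorem opOf_eq_relHom {m n : ℕ} (σ : Gen m n) : opOf X σ = relHom X (rel (.gen σ)) :=
  eq_relHom fun j => by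
    have rel_gen : rel (.gen σ) = fun _ _ => True := rfl
    simp only [rel_gen, relProj, Finset.filter_true]
    cases σ with
    | mul => rw [Fin.prod_univ_two, Subsingleton.elim j 0, opOf_mul_powProj]
    | unit => rw [Finset.univ_eq_empty, Finset.prod_empty, Subsingleton.elim j 0, opOf_unit_powProj]
    | comul => rw [Fin.prod_univ_one, opOf_comul_powProj]
    | counit => exact j.elim0

theorem eval_eq_relHom [IsSpecial X] {m n : ℕ} (t : Term Gen m n) :
    t.eval X (opOf X) = relHom X (rel t) := by
  induction t with
  | gen σ => exact opOf_eq_relHom X σ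
  | id n => exact id_eq_relHom X n
  | braid m n => exact powBraid_eq_relHom X m n
  | comp s t ihs iht => exact (congrArg₂ (· ≫ ·) ihs iht).trans (relHom_comp X _ _)
  | tensor s t ihs iht => exact (congrArg₂ powTensor ihs iht).trans (powTensor_relHom X _ _)

end Evaluation

attribute [local instance] ComonObj.instTensorUnit convCommMonoid

/-- The generating object of the prop for special bicommutative bimonoids. -/
abbrev genObj : sbb.prop.Ob := ⟨1⟩

/-- The morphism of the prop for special bicommutative bimonoids represented by a term. -/
def mk {m n : ℕ} (t : Term Gen m n) : (⟨m⟩ : sbb.prop.Ob) ⟶ ⟨n⟩ := sbb.ofTerm t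

theorem mk_eq {m n : ℕ} {s t : Term Gen m n} (h : Eqn s t) : mk s = mk t :=
  Quot.sound (.of h)

/-- The multiplication of the generating object. -/
def genMul : genObj ⊗ genObj ⟶ genObj := mk mul

/-- The unit of the generating object. -/
def genUnit : 𝟙_ sbb.prop.Ob ⟶ genObj := mk unit

/-- The comultiplication of the generating object. -/
def genComul : genObj ⟶ genObj ⊗ genObj := mk comul

/-- The counit of the generating object. -/
def genCounit : genObj ⟶ 𝟙_ sbb.prop.Ob := mk counit

theorem braiding_genMul : (β_ genObj genObj).hom ≫ genMul = genMul := mk_eq .comm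

theorem genComul_braiding : genComul ≫ (β_ genObj genObj).hom = genComul := mk_eq .cocomm

theorem genUnit_genMul : genUnit ▷ genObj ≫ genMul = (λ_ genObj).hom := mk_eq .unit_left

theorem genComul_genCounit : genComul ≫ genCounit ▷ genObj = (λ_ genObj).inv :=
  mk_eq .counit_left

instance : MonObj genObj where
  one := genUnit
  mul := genMul
  one_mul := genUnit_genMul
  mul_one := by
    rw [← braiding_genMul, BraidedCategory.braiding_naturality_right_assoc, genUnit_genMul,
      braiding_leftUnitor]
  mul_assoc :=
    (mk_eq .assoc).trans (sbb.prop.id_comp (mk (.comp (.tensor (m := 1) one mul) mul))).symm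

instance : ComonObj genObj where
  counit := genCounit
  comul := genComul
  counit_comul := genComul_genCounit
  comul_counit := by
    rw [← genComul_braiding, Category.assoc, ← BraidedCategory.braiding_naturality_left,
      reassoc_of% genComul_genCounit, leftUnitor_inv_braiding]
  comul_assoc :=
    (mk_eq .coassoc).symm.trans (congrArg (sbb.prop.comp (mk comul))
      (sbb.prop.comp_id (mk (.tensor (n := 2) (q := 1) comul one))).symm)

instance : IsCommMonObj genObj where
  mul_comm := braiding_genMul

instance : IsCommComonObj genObj where
  comul_comm := genComul_braiding

/-- The exchange of the two middle strands on four copies of the generating object. -/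
def genExch : (genObj ⊗ genObj) ⊗ genObj ⊗ genObj ⟶ (genObj ⊗ genObj) ⊗ genObj ⊗ genObj := mk exch

theorem tensorμ_genObj : tensorμ genObj genObj genObj genObj = genExch := by
  have assoc_eq_id (P : PROP.{0}) (f : P.Hom 3 3) :
      P.comp (P.id 4) (P.comp (P.tensor (P.id 1) (P.id 3))
        (P.comp (P.tensor (P.id 1) f) (P.comp (P.tensor (P.id 1) (P.id 3)) (P.id 4)))) =
      P.tensor (P.id 1) f := by
    rw [P.tensor_id, P.comp_id, P.comp_id, P.id_comp, P.id_comp]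
  exact assoc_eq_id sbb.prop (sbb.prop.tensor (sbb.prop.braid 1 1) (sbb.prop.id 1))

instance : BimonObj genObj where
  mul_comul := by
    rw [tensorμ_genObj]
    exact mk_eq .mul_comul
  one_comul := (mk_eq .unit_comul).trans (sbb.prop.id_comp _).symm
  mul_counit := (mk_eq .mul_counit).trans (sbb.prop.comp_id _).symm
  one_counit := mk_eq .extra

instance : IsSpecial genObj where
  comul_mul := mk_eq .special

/-- The object `n` as a tensor power of the generating object. -/
abbrev genPow (n : ℕ) : pow genObj n ≅ ⟨n⟩ := PROP.powIso (𝟭 sbb.prop.Ob) n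

theorem genPow_one : genPow 1 = λ_ genObj := Iso.ext (PROP.powIso_one_hom _)

theorem genPow_two : genPow 2 = whiskerRightIso (λ_ genObj) genObj :=
  Iso.ext ((Category.comp_id _).trans
    (congrArg (fun e : pow genObj 1 ≅ genObj => e.hom ▷ genObj) genPow_one))

theorem opOf_genObj {m n : ℕ} (σ : Gen m n) :
    opOf genObj σ = (genPow m).hom ≫ mk (.gen σ) ≫ (genPow n).inv := by
  cases σ with
  | mul => rw [genPow_one, genPow_two]; rfl
  | unit => rw [genPow_one]; exact (Category.id_comp _).symm
  | comul => rw [genPow_one, genPow_two]; rfl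
  | counit => rw [genPow_one]; exact congrArg (_ ≫ ·) (Category.comp_id _).symm

theorem eval_genObj {m n : ℕ} (t : Term Gen m n) :
    t.eval genObj (opOf genObj) = (genPow m).hom ≫ mk t ≫ (genPow n).inv := by
  let A : Algebra sbb.prop sbb.prop.Ob := ⟨𝟭 sbb.prop.Ob⟩
  have opOf_eq : @opOf _ _ _ genObj _ _ = fun {m n : ℕ} (σ : Gen m n) => A.op σ := by
    funext m n σ
    exact opOf_genObj σ
  have eval_comp_genPow : t.eval genObj (opOf genObj) ≫ (genPow n).hom = (genPow m).hom ≫ mk t := by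
    rw [opOf_eq]
    exact A.eval_comp_powIso_hom t
  rw [← reassoc_of% eval_comp_genPow, Iso.hom_inv_id, Category.comp_id]

theorem mk_eq_conj_relHom {m n : ℕ} (t : Term Gen m n) :
    mk t = (genPow m).inv ≫ relHom genObj (rel t) ≫ (genPow n).hom := by
  rw [← eval_eq_relHom, eval_genObj]
  simp

theorem id_ne_counit_unit : 𝟙 genObj ≠ ε[genObj] ≫ η[genObj] := by
  intro h
  have rel_eq : rel one = rel (.comp counit unit) := congrArg (PROP.Morphism.map toRel) h
  obtain ⟨k, -⟩ : rel (.comp counit unit) 0 0 := rel_eq ▸ rfl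
  exact k.elim0

theorem toRel_bijective (m n : ℕ) :
    Function.Bijective (fun f : sbb.prop.Hom m n => PROP.Morphism.map toRel f) := by
  refine ⟨?_, fun R => ?_⟩
  · rintro ⟨s⟩ ⟨t⟩ (h : rel s = rel t)
    exact (mk_eq_conj_relHom s).trans (h ▸ (mk_eq_conj_relHom t).symm)
  · obtain ⟨t, ht⟩ : ∃ t, mk t = (genPow m).inv ≫ relHom genObj R ≫ (genPow n).hom :=
      sbb.exists_ofTerm_eq _
    rw [mk_eq_conj_relHom, Iso.cancel_iso_inv_left, Iso.cancel_iso_hom_right] at ht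
    exact ⟨mk t, relHom_injective genObj id_ne_counit_unit m n ht⟩

theorem nonempty_relProp_iso_prop : Nonempty (relProp ≅ sbb.prop) :=
  ⟨(PROP.isoOfBijective toRel toRel_bijective).symm⟩

end SBB

/-! ### The equivalence with finite sets and relations -/

namespace RelProp

/-- The functor sending `n` to the finite set `Fin n`. -/
def toFinRel : relProp.Ob ⥤ FinRel where
  obj n := ⟨Fin n.val⟩
  map R := R
  map_id _ := rfl
  map_comp _ _ := rfl

instance : toFinRel.Full where
  map_surjective R := ⟨R, rfl⟩

instance : toFinRel.Faithful where
  map_injective h := h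

instance : toFinRel.EssSurj where
  mem_essImage X := by
    obtain ⟨n, ⟨e⟩⟩ := Finite.exists_equiv_fin X.carrier
    exact ⟨⟨n⟩, ⟨FinRel.graphIso (X := toFinRel.obj ⟨n⟩) (Y := X) e.symm⟩⟩

instance : toFinRel.IsEquivalence where

/-- The comparison of the tensor units. -/
def unitIso : 𝟙_ FinRel ≅ toFinRel.obj (𝟙_ relProp.Ob) :=
  FinRel.graphIso (X := 𝟙_ FinRel) (Y := toFinRel.obj (𝟙_ relProp.Ob))
    (Equiv.equivOfIsEmpty Empty (Fin 0))

/-- The comparison of the tensor products. -/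
def tensorIso (m n : relProp.Ob) : toFinRel.obj m ⊗ toFinRel.obj n ≅ toFinRel.obj (m ⊗ n) :=
  FinRel.graphIso (X := toFinRel.obj m ⊗ toFinRel.obj n) (Y := toFinRel.obj (m ⊗ n))
    finSumFinEquiv

theorem map_eqIso_hom {m n : relProp.Ob} (h : m.val = n.val) :
    toFinRel.map (relProp.eqIso h).hom =
      (FinRel.graphIso (X := toFinRel.obj m) (Y := toFinRel.obj n) (finCongr h)).hom := by
  obtain ⟨m⟩ := m
  obtain ⟨n⟩ := n
  obtain rfl : m = n := h
  rfl

theorem map_braiding_hom (m n : relProp.Ob) :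
    toFinRel.map (β_ m n).hom = (FinRel.graphIso (X := toFinRel.obj (m ⊗ n))
      (Y := toFinRel.obj (n ⊗ m))
      (finSumFinEquiv.symm.trans ((Equiv.sumComm _ _).trans finSumFinEquiv))).hom :=
  FinRel.hom_ext fun _ _ => Equiv.eq_symm_apply _

theorem tensorIso_hom_natural {m n p q : relProp.Ob} (R : m ⟶ n) (S : p ⟶ q) :
    (toFinRel.map R ⊗ₘ toFinRel.map S) ≫ (tensorIso n q).hom =
      (tensorIso m p).hom ≫ toFinRel.map (R ⊗ₘ S) :=
  FinRel.natural_of _ _ _ _ fun x j =>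
    iff_of_eq (congrArg (Sum.LiftRel R S · (finSumFinEquiv.symm j))
      (finSumFinEquiv.symm_apply_apply x).symm)

theorem tensorIso_hom_associativity (l m n : relProp.Ob) :
    ((tensorIso l m).hom ⊗ₘ 𝟙 (toFinRel.obj n)) ≫ (tensorIso (l ⊗ m) n).hom ≫
        toFinRel.map (α_ l m n).hom =
      (α_ (toFinRel.obj l) (toFinRel.obj m) (toFinRel.obj n)).hom ≫
        (𝟙 (toFinRel.obj l) ⊗ₘ (tensorIso m n).hom) ≫ (tensorIso l (m ⊗ n)).hom := by
  refine (congrArg₂ (· ≫ ·) (FinRel.tensor_graphIso_id _ _)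
    ((congrArg (_ ≫ ·) (map_eqIso_hom _)).trans (FinRel.graphIso_comp_graphIso _ _))).trans ?_
  refine (FinRel.graphIso_comp_graphIso _ _).trans (Eq.symm ?_)
  refine (congrArg (_ ≫ ·) ((congrArg (· ≫ _) (FinRel.tensor_id_graphIso _ _)).trans
    (FinRel.graphIso_comp_graphIso _ _))).trans ?_
  refine (FinRel.graphIso_comp_graphIso _ _).trans (FinRel.graphIso_congr ?_)
  rintro ((x | x) | x)
  · rfl
  · rfl
  · exact Fin.ext (Nat.add_assoc _ _ _).symm

theorem tensorIso_hom_left_unitality (n : relProp.Ob) :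
    (λ_ (toFinRel.obj n)).hom = (unitIso.hom ⊗ₘ 𝟙 (toFinRel.obj n)) ≫
      (tensorIso (𝟙_ relProp.Ob) n).hom ≫ toFinRel.map (λ_ n).hom := by
  refine Eq.trans ?_ (congrArg₂ (· ≫ ·) (FinRel.tensor_graphIso_id _ _)
    ((congrArg (_ ≫ ·) (map_eqIso_hom _)).trans (FinRel.graphIso_comp_graphIso _ _))).symm
  refine Eq.trans (FinRel.graphIso_congr ?_) (FinRel.graphIso_comp_graphIso _ _).symm
  rintro (x | x)
  · exact x.elim
  · exact Fin.ext (Nat.zero_add _).symm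

theorem tensorIso_hom_right_unitality (n : relProp.Ob) :
    (ρ_ (toFinRel.obj n)).hom = (𝟙 (toFinRel.obj n) ⊗ₘ unitIso.hom) ≫
      (tensorIso n (𝟙_ relProp.Ob)).hom ≫ toFinRel.map (ρ_ n).hom := by
  refine Eq.trans ?_ (congrArg₂ (· ≫ ·) (FinRel.tensor_id_graphIso _ _)
    ((congrArg (_ ≫ ·) (map_eqIso_hom _)).trans (FinRel.graphIso_comp_graphIso _ _))).symm
  refine Eq.trans (FinRel.graphIso_congr ?_) (FinRel.graphIso_comp_graphIso _ _).symm
  rintro (x | x)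
  · rfl
  · exact x.elim

instance : toFinRel.Monoidal :=
  Functor.CoreMonoidal.toMonoidal
    { εIso := unitIso
      μIso := tensorIso
      μIso_hom_natural_left R n := tensorIso_hom_natural R (𝟙 n)
      μIso_hom_natural_right n R := tensorIso_hom_natural (𝟙 n) R
      associativity := tensorIso_hom_associativity
      left_unitality := tensorIso_hom_left_unitality
      right_unitality := tensorIso_hom_right_unitality }

instance : toFinRel.Braided where
  braided m n := by
    change (tensorIso m n).hom ≫ _ = (FinRel.swapIso _ _).hom ≫ (tensorIso n m).hom
    refine (congrArg (_ ≫ ·) (map_braiding_hom m n)).trans ?_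
    refine (FinRel.graphIso_comp_graphIso _ _).trans ?_
    refine Eq.trans (FinRel.graphIso_congr fun x => ?_) (FinRel.graphIso_comp_graphIso _ _).symm
    exact congrArg (fun y => finSumFinEquiv (Sum.swap y)) (finSumFinEquiv.symm_apply_apply x)

end RelProp

end SymMonTheory

/-- The prop `relProp` of relations is equivalent, as a symmetric monoidal category, to the category
of finite sets and relations with disjoint union; `sbb.prop` is the prop for special bicommutative
bimonoids; and these two props are isomorphic. -/
theorem mainTheorem2 :
    (∃ (F : SymMonTheory.relProp.Ob ⥤ SymMonTheory.FinRel) (_ : F.Braided), F.IsEquivalence) ∧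
      SymMonTheory.IsPropFor.{v, u, 0} SymMonTheory.sbb.prop SymMonTheory.sbb ∧
      Nonempty (SymMonTheory.relProp ≅ SymMonTheory.sbb.prop) :=
  ⟨⟨SymMonTheory.RelProp.toFinRel, inferInstance, inferInstance⟩,
    SymMonTheory.isPropFor_prop SymMonTheory.sbb, SymMonTheory.SBB.nonempty_relProp_iso_prop⟩
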